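/- Let $n\ge 1$ be an integer, $\sigma\ge 1$, $s\ge 0$, $\ell\ge 0$ and $m\in[1,2]$. Put $$A_0=\begin{pmatrix} i&0&0\\0&-i&0\\0&0&0\end{pmatrix},\qquad A_1=\begin{pmatrix}0&0&1\\0&0&1\\-\frac12&-\frac12&-1\end{pmatrix}.$$ There is a constant $C>0$, depending only on $n,\sigma,s,\ell,m$, such that for every $U_0\in (H^{s+\ell}(\mathbb{R}^n)\cap L^m(\mathbb{R}^n))^3$ (complex-valued) the Cauchy problem $$U_t-A_0(-\Delta)^{\sigma/2}U-A_1U=0\quad (x\in\mathbb{R}^n,\ t>0),\qquad U(0,x)=U_0(x),$$ has a unique solution $U\in C([0,\infty);(L^2(\mathbb{R}^n))^3)$, and $$\|U(t,\cdot)\|_{(\dot H^{s}(\mathbb{R}^n))^3}\le C\left((1+t)^{-\frac{n}{2\sigma}\left(\frac1m-\frac12\right)-\frac{s}{2\sigma}}\|U_0\|_{(L^m(\mathbb{R}^n))^3}+(1+t)^{-\frac{\ell}{2\sigma}}\|U_0\|_{(H^{s+\ell}(\mathbb{R}^n))^3}\right)\qquad\text{for all } t\ge 0.$$ Here $(-\Delta)^{\sigma/2}$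 is the Fourier multiplier with symbol $|\xi|^{\sigma}$, $\|f\|_{\dot H^s}=\||\xi|^s\hat f\|_{L^2}$ and $\|f\|_{H^s}=\|(1+|\xi|^2)^{s/2}\hat f\|_{L^2}$ with $\hat f$ the unitary Fourier transform in the angular frequency $\xi$. The system is understood in the sense of distributions in $x$: for every Schwartz function $\varphi$ on $\mathbb{R}^n$, the function $t\mapsto\int_{\mathbb{R}^n}\varphi\,U(t,\cdot)\,dx$ is differentiable for $t>0$ with derivative $\int_{\mathbb{R}^n}\left((-\Delta)^{\sigma/2}\varphi\right)A_0U(t,\cdot)\,dx+\int_{\mathbb{R}^n}\varphi\, A_1U(t,\cdot)\,dx$. -/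

import Mathlib

open MeasureTheory FourierTransform
open scoped SchwartzMap ENNReal

noncomputable section

namespace SigmaEvolution

/-- The space `ℝⁿ` with its Euclidean norm. -/
abbrev Rn (n : ℕ) : Type := EuclideanSpace ℝ (Fin n)

/-- The space `ℂ³` with its Hermitian norm. -/
abbrev C3 : Type := EuclideanSpace ℂ (Fin 3)

/-- `(L²(ℝⁿ))³`, as the space `L²(ℝⁿ; ℂ³)`. -/
abbrev L2 (n : ℕ) : Type := Lp C3 2 (volume : Measure (Rn n))

/-- The coefficient matrix `A₀`. -/
def A₀ : Matrix (Fin 3) (Fin 3) ℂ :=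
  !![Complex.I, 0, 0;
     0, -Complex.I, 0;
     0, 0, 0]

/-- The coefficient matrix `A₁`. -/
def A₁ : Matrix (Fin 3) (Fin 3) ℂ :=
  !![0, 0, 1;
     0, 0, 1;
     -(1 / 2), -(1 / 2), -1]

/-- The action of a `3 × 3` matrix on `ℂ³`. -/
def act (A : Matrix (Fin 3) (Fin 3) ℂ) (v : C3) : C3 := WithLp.toLp 2 (A.mulVec v.ofLp)

/-- The fractional Laplacian `(-Δ)^α φ` of a Schwartz function: the Fourier multiplier with symbol
`|ξ|^(2α)` for the kernel `exp (-i x·ξ)`. As Mathlib's Fourier transform has the kernel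
`exp (-2πi x·ξ)`, the frequency is `2πξ` in terms of Mathlib's variable `ξ`. -/
def fracLaplacian {n : ℕ} (α : ℝ) (φ : 𝓢(Rn n, ℂ)) : Rn n → ℂ :=
  𝓕⁻ (fun ξ : Rn n => (((2 * Real.pi * ‖ξ‖) ^ (2 * α) : ℝ) : ℂ) * 𝓕 (φ : Rn n → ℂ) ξ)

/-- `U ∈ C([0,∞); L²)` is the solution of `U_t - A₀ (-Δ)^(σ/2) U - A₁ U = 0` for `t > 0`,
`U(0) = U₀`. The system holds in the distributional sense in `x`: as `U(t)` is merely in `L²`, the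
operator `(-Δ)^(σ/2)`, which is its own transpose, is moved to the test function. Only the values
of `U` at times `t ≥ 0` matter. -/
structure IsSolution {n : ℕ} (σ : ℝ) (U₀ : L2 n) (U : ℝ → L2 n) : Prop where
  continuousOn : ContinuousOn U (Set.Ici 0)
  initial : U 0 = U₀
  system : ∀ φ : 𝓢(Rn n, ℂ), ∀ t : ℝ, 0 < t →
    HasDerivAt (fun τ : ℝ => ∫ x, φ x • U τ x)
      ((∫ x, fracLaplacian (σ / 2) φ x • act A₀ (U t x)) + ∫ x, φ x • act A₁ (U t x)) t

/-- The homogeneous norm `‖f‖_{Ḣ^s} = ‖|D|^s f‖_{L²}`, with value `∞` if `f ∉ Ḣ^s`. It is the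
`L²` norm of `|ξ|^s` times the (Plancherel) Fourier transform of `f`. -/
def homSobolevNorm {n : ℕ} (s : ℝ) (f : L2 n) : ℝ≥0∞ :=
  eLpNorm (fun ξ : Rn n => (2 * Real.pi * ‖ξ‖) ^ s • (𝓕 f : L2 n) ξ) 2 volume

/-- The norm `‖f‖_{H^s} = ‖(1 - Δ)^(s/2) f‖_{L²}`, with value `∞` if `f ∉ H^s`. It is the `L²`
norm of `(1 + |ξ|²)^(s/2)` times the (Plancherel) Fourier transform of `f`. -/
def sobolevNorm {n : ℕ} (s : ℝ) (f : L2 n) : ℝ≥0∞ :=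
  eLpNorm (fun ξ : Rn n => (1 + (2 * Real.pi * ‖ξ‖) ^ 2) ^ (s / 2) • (𝓕 f : L2 n) ξ) 2 volume

/-- `f ∈ H^s(ℝⁿ; ℂ³)` for `f ∈ L²`; for `s ≥ 0` every element of `H^s` is in `L²`. -/
def MemH {n : ℕ} (s : ℝ) (f : L2 n) : Prop := sobolevNorm s f < ∞

end SigmaEvolution

end

/-! On the Fourier side the system is, at each frequency, the linear ODE v' = (ρ A₀ + A₁) v with ρ =
|ξ|^σ. Only the third component is damped directly; the coupling passes the damping on to the other
two, at the rate ρ²/(1+ρ²)² up to a constant. `lyapunov_decay` shows this without eigenvalues, by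
adding small cross terms to the energy, and `norm_prop_apply_le` turns it into a bound of the
propagator with constants independent of ρ.

The rate behaves like |ξ|^(2σ) near zero and like |ξ|^(-2σ) at infinity. For |ξ| ≤ 1 the propagator
is dominated by exp(-c|ξ|^(2σ)(1+t)), and rescaling frequencies by R = (1+t)^(-1/(2σ)) gives the
decay from L^m data. For |ξ| ≥ 1, exp(-ct|ξ|^(-2σ)) is at most a constant times (1+t)^(-ℓ/(2σ))
|ξ|^ℓ: decay is paid for with ℓ derivatives. `exists_norm_prop_le` joins the two regimes. In place
of Hausdorff-Young and Hölder, `eLpNorm_weight_smul_fourier_le` splits the datum at a height r into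
a part in L¹, whose transform is bounded, and a part in L², handled by Plancherel; r is then chosen
to balance both.

By `isSolution_iff` the weak formulation can be read on the Fourier side. Existence is
differentiation under the integral sign. For uniqueness, the symbol cut off to a ball of frequencies
is a bounded operator on L², so the cut-off solution solves an ODE with Lipschitz right-hand side;
the radius is arbitrary. -/

noncomputable section

namespace SigmaEvolution

/-! ### The Plancherel transform in duality with test functions -/

section Plancherel

variable {E F : Type*} [NormedAddCommGroup E] [MeasurableSpace E] [BorelSpace E]
  [InnerProductSpace ℝ E] [FiniteDimensional ℝ E]
  [NormedAddCommGroup F] [InnerProductSpace ℂ F]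

theorem continuous_fourier_of_integrable {f : E → F} (hf : Integrable f) : Continuous (𝓕 f) :=
  VectorFourier.fourierIntegral_continuous Real.continuous_fourierChar
    (L := innerₗ E) continuous_inner hf

theorem norm_fourier_le_integral_norm (f : E → F) (x : E) : ‖𝓕 f x‖ ≤ ∫ y, ‖f y‖ :=
  VectorFourier.norm_fourierIntegral_le_integral_norm Real.fourierChar volume (innerₗ E) f x

variable [CompleteSpace F]

/-- Self-adjointness of the Fourier integral, tested against Schwartz functions. -/
theorem integral_fourier_smul_eq_of_integrable {g : E → ℂ} {f : E → F} (hg : Integrable g)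
    (hf : Integrable f) : ∫ x, 𝓕 g x • f x = ∫ x, g x • 𝓕 f x := by
  have := VectorFourier.integral_fourierIntegral_smul_eq_flip (L := innerₗ E) (μ := volume)
    (ν := volume) (e := Real.fourierChar) Real.continuous_fourierChar continuous_inner hg hf
  simpa [Real.fourier_eq, VectorFourier.fourierIntegral, real_inner_comm] using this

/-- On `L¹ ∩ L²`, the Plancherel transform is the Fourier integral. -/
theorem fourier_toLp_ae_eq {f : E → F} (hf : Integrable f) (hf' : MemLp f 2) :
    (𝓕 (hf'.toLp f) : Lp F 2 (volume : Measure E)) =ᵐ[volume] 𝓕 f := by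
  apply ae_eq_of_integral_contDiff_smul_eq
  · exact (Lp.memLp _).locallyIntegrable (by norm_num)
  · exact (continuous_fourier_of_integrable hf).locallyIntegrable
  intro g hg hgc
  let G : 𝓢(E, ℂ) := HasCompactSupport.toSchwartzMap
    (f := fun x => (g x : ℂ)) (by exact hgc.comp_left Complex.ofReal_zero)
    (Complex.ofRealCLM.contDiff.comp hg)
  have hG : ∀ x, G x = (g x : ℂ) := fun x => rfl
  have h1 := congrArg (fun T => T G) (Lp.fourier_toTemperedDistribution_eq (hf'.toLp f))
  simp only [TemperedDistribution.fourier_apply, Lp.toTemperedDistribution_apply, hG] at h1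
  have h2 : ∫ x, (𝓕 G) x • (hf'.toLp f) x = ∫ x, (𝓕 G) x • f x := by
    apply integral_congr_ae
    filter_upwards [hf'.coeFn_toLp] with x hx
    rw [hx]
  rw [h2, SchwartzMap.fourier_coe, integral_fourier_smul_eq_of_integrable G.integrable hf] at h1
  simpa [hG, ← Complex.coe_smul] using h1.symm

/-- The Plancherel identity in bilinear form, for a Schwartz function. -/
theorem integral_fourierInv_smul_fourier (φ : 𝓢(E, ℂ)) (f : Lp F 2 (volume : Measure E)) :
    ∫ x, (𝓕⁻ φ) x • (𝓕 f : Lp F 2 (volume : Measure E)) x = ∫ x, φ x • f x := by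
  have h1 := congrArg (fun T => T (𝓕⁻ φ)) (Lp.fourier_toTemperedDistribution_eq f)
  simp only [TemperedDistribution.fourier_apply, Lp.toTemperedDistribution_apply] at h1
  rw [← h1, FourierTransform.fourier_fourierInv_eq]

/-- The pairing of two functions in `L²` is continuous in the second. -/
theorem continuous_integral_smul {h : E → ℂ} (hh : MemLp h 2) :
    Continuous fun f : Lp F 2 (volume : Measure E) => ∫ x, h x • f x := by
  have := ((ContinuousLinearMap.lsmul ℂ ℂ (E := F)).lpPairing (volume : Measure E) 2 2
    (hh.toLp h)).continuous
  convert this using 2 with f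
  rw [ContinuousLinearMap.lpPairing_eq_integral]
  apply integral_congr_ae
  filter_upwards [hh.coeFn_toLp] with x hx
  simp [hx]

/-- Self-adjointness of the Fourier transform, between `L¹ ∩ L²` and `L²`. -/
theorem integral_fourier_smul {h : E → ℂ} (hh : Integrable h) (hh' : MemLp h 2)
    (hF : MemLp (𝓕 h) 2) (f : Lp F 2 (volume : Measure E)) :
    ∫ x, 𝓕 h x • f x = ∫ x, h x • (𝓕 f : Lp F 2 (volume : Measure E)) x := by
  -- Both sides are continuous in f on L², the left one because 𝓕 h is in L²; for Schwartz f both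
  -- factors are integrable and the classical identity applies.
  refine DenseRange.induction_on (p := fun f : Lp F 2 (volume : Measure E) =>
    ∫ x, 𝓕 h x • f x = ∫ x, h x • (𝓕 f : Lp F 2 (volume : Measure E)) x)
    (SchwartzMap.denseRange_toLpCLM (p := 2) ENNReal.ofNat_ne_top) f ?_ ?_
  · exact isClosed_eq (continuous_integral_smul hF)
      ((continuous_integral_smul hh').comp (Lp.fourierTransformₗᵢ E F).continuous)
  intro g
  have e1 : ∫ x, 𝓕 h x • (g.toLp 2 volume) x = ∫ x, 𝓕 h x • g x := by
    apply integral_congr_ae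
    filter_upwards [g.coeFn_toLp 2 volume] with x hx
    rw [hx]
  have e2 : ∫ x, h x • ((𝓕 g).toLp 2 volume) x = ∫ x, h x • (𝓕 g) x := by
    apply integral_congr_ae
    filter_upwards [(𝓕 g).coeFn_toLp 2 volume] with x hx
    rw [hx]
  simp only [SchwartzMap.toLpCLM_apply, SchwartzMap.toLp_fourier_eq]
  rw [e1, e2, SchwartzMap.fourier_coe, integral_fourier_smul_eq_of_integrable hh g.integrable]

theorem memLp_fourier {h : E → F} (hh : Integrable h) (hh' : MemLp h 2) : MemLp (𝓕 h) 2 :=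
  (memLp_congr_ae (fourier_toLp_ae_eq hh hh')).1 (Lp.memLp _)

end Plancherel

/-! ### The symbol, and the weak formulation on the Fourier side -/

/-- The symbol `|ξ|^σ` of `(-Δ)^(σ/2)`, in terms of Mathlib's frequency variable. -/
def freq {n : ℕ} (σ : ℝ) (ξ : Rn n) : ℝ := (2 * Real.pi * ‖ξ‖) ^ σ

theorem freq_nonneg {n : ℕ} (σ : ℝ) (ξ : Rn n) : 0 ≤ freq σ ξ := by
  unfold freq; positivity

theorem continuous_freq {n : ℕ} {σ : ℝ} (hσ : 0 ≤ σ) : Continuous (freq σ : Rn n → ℝ) := by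
  unfold freq
  exact (continuous_const.mul continuous_norm).rpow_const fun _ => Or.inr hσ

/-- The action of a matrix on `ℂ³` as a continuous linear map. -/
def matCLM (A : Matrix (Fin 3) (Fin 3) ℂ) : C3 →L[ℂ] C3 := Matrix.toEuclideanCLM (𝕜 := ℂ) A

theorem matCLM_apply (A : Matrix (Fin 3) (Fin 3) ℂ) (v : C3) : matCLM A v = act A v := rfl

/-- The symbol `ρ A₀ + A₁` of the system at frequency `ρ`. -/
def symb (ρ : ℝ) : C3 →L[ℂ] C3 := (ρ : ℂ) • matCLM A₀ + matCLM A₁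

theorem continuous_symb : Continuous symb := by
  unfold symb; fun_prop

theorem norm_symb_le {ρ : ℝ} (hρ : 0 ≤ ρ) :
    ‖symb ρ‖ ≤ (‖matCLM A₀‖ + ‖matCLM A₁‖) * (1 + ρ) := by
  have h : ‖symb ρ‖ ≤ ρ * ‖matCLM A₀‖ + ‖matCLM A₁‖ := by
    refine (norm_add_le _ _).trans ?_
    rw [norm_smul, Complex.norm_real, Real.norm_of_nonneg hρ]
  nlinarith [norm_nonneg (matCLM A₀), norm_nonneg (matCLM A₁),
    mul_nonneg hρ (norm_nonneg (matCLM A₁))]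

section Weak

variable {n : ℕ} {σ : ℝ}

/-- The symbol is even, so 𝓕 and 𝓕⁻ can be exchanged. In this form self-adjointness of 𝓕 moves the
outer transform onto the solution. -/
theorem fracLaplacian_eq (φ : 𝓢(Rn n, ℂ)) :
    fracLaplacian (σ / 2) φ = 𝓕 fun ξ : Rn n => (freq σ ξ : ℂ) * (𝓕⁻ φ) ξ := by
  unfold fracLaplacian
  rw [Real.fourierInv_eq_fourier_comp_neg]
  congr 1
  ext ξ
  have h : 2 * (σ / 2) = σ := by ring
  rw [SchwartzMap.fourierInv_coe, Real.fourierInv_eq_fourier_neg, norm_neg, h, freq]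

/-- As |ξ|^σ need not be smooth at the origin, the product need not be Schwartz. Decay of order n +
1 is enough to place it in L¹ ∩ L². -/
theorem freq_mul_schwartz_le (hσ : 1 ≤ σ) (ψ : 𝓢(Rn n, ℂ)) :
    ∃ C : ℝ, ∀ ξ, freq σ ξ * ‖ψ ξ‖ ≤ C * (1 + ‖ξ‖) ^ (-((n : ℝ) + 1)) := by
  obtain ⟨N, hN⟩ := exists_nat_ge (σ + (n + 1))
  obtain ⟨C, hC⟩ : ∃ C : ℝ, ∀ ξ, (1 + ‖ξ‖) ^ N * ‖ψ ξ‖ ≤ C := by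
    refine ⟨2 ^ N * ((Finset.Iic (N, 0)).sup fun m => SchwartzMap.seminorm ℂ m.1 m.2) ψ,
      fun ξ => ?_⟩
    have := SchwartzMap.one_add_le_sup_seminorm_apply (𝕜 := ℂ) (m := (N, 0)) (le_refl N)
      (le_refl 0) ψ ξ
    simpa using this
  refine ⟨(2 * Real.pi) ^ σ * C, fun ξ => ?_⟩
  have h0 : (0 : ℝ) < 1 + ‖ξ‖ := by positivity
  have h1 : freq σ ξ ≤ (2 * Real.pi) ^ σ * (1 + ‖ξ‖) ^ σ := by
    rw [freq, Real.mul_rpow (by positivity) (by positivity)]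
    gcongr
    linarith
  have h2 : (1 + ‖ξ‖) ^ σ ≤ (1 + ‖ξ‖) ^ N * (1 + ‖ξ‖) ^ (-((n : ℝ) + 1)) := by
    rw [← Real.rpow_natCast, ← Real.rpow_add h0]
    exact Real.rpow_le_rpow_of_exponent_le (by linarith [norm_nonneg ξ]) (by linarith)
  calc freq σ ξ * ‖ψ ξ‖
      ≤ ((2 * Real.pi) ^ σ * ((1 + ‖ξ‖) ^ N * (1 + ‖ξ‖) ^ (-((n : ℝ) + 1)))) * ‖ψ ξ‖ := by
        gcongr
        exact h1.trans (by gcongr)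
    _ = (2 * Real.pi) ^ σ * ((1 + ‖ξ‖) ^ N * ‖ψ ξ‖) * (1 + ‖ξ‖) ^ (-((n : ℝ) + 1)) := by ring
    _ ≤ _ := by
        gcongr
        exact hC ξ

theorem memLp_of_le_one_add_norm {E : Type*} [NormedAddCommGroup E] {f : Rn n → E}
    (hf : AEStronglyMeasurable f volume) {C : ℝ}
    (h : ∀ ξ, ‖f ξ‖ ≤ C * (1 + ‖ξ‖) ^ (-((n : ℝ) + 1))) : Integrable f ∧ MemLp f 2 := by
  have hI : Integrable fun ξ : Rn n => C * (1 + ‖ξ‖) ^ (-((n : ℝ) + 1)) :=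
    (integrable_one_add_norm (by simp)).const_mul C
  have h1 : Integrable f := hI.mono' hf (Filter.Eventually.of_forall h)
  refine ⟨h1, ?_⟩
  have hb : ∀ ξ, ‖f ξ‖ ≤ |C| := fun ξ => by
    refine (h ξ).trans ?_
    have h3 : (1 + ‖ξ‖) ^ (-((n : ℝ) + 1)) ≤ 1 :=
      Real.rpow_le_one_of_one_le_of_nonpos (by linarith [norm_nonneg ξ])
        (by linarith [Nat.cast_nonneg (α := ℝ) n])
    have h4 : (0 : ℝ) ≤ (1 + ‖ξ‖) ^ (-((n : ℝ) + 1)) := by positivity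
    nlinarith [le_abs_self C, abs_nonneg C]
  refine (memLp_two_iff_integrable_sq_norm hf).2 ((h1.norm.const_mul |C|).mono' (hf.norm.pow 2) ?_)
  refine Filter.Eventually.of_forall fun ξ => ?_
  rw [Real.norm_of_nonneg (by positivity), sq]
  exact mul_le_mul_of_nonneg_right (hb ξ) (norm_nonneg _)

theorem freq_mul_schwartz (hσ : 1 ≤ σ) (ψ : 𝓢(Rn n, ℂ)) :
    Integrable (fun ξ => (freq σ ξ : ℂ) * ψ ξ) ∧ MemLp (fun ξ => (freq σ ξ : ℂ) * ψ ξ) 2 := by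
  obtain ⟨C, hC⟩ := freq_mul_schwartz_le hσ ψ
  refine memLp_of_le_one_add_norm (C := C) ?_ fun ξ => ?_
  · exact ((Complex.continuous_ofReal.comp (continuous_freq (zero_le_one.trans hσ))).mul
      ψ.continuous).aestronglyMeasurable
  · rw [norm_mul, Complex.norm_real, Real.norm_of_nonneg (freq_nonneg σ ξ)]
    exact hC ξ

theorem integrable_smul_of_memLp {g : Rn n → ℂ} {f : Rn n → C3} (hg : MemLp g 2)
    (hf : MemLp f 2) : Integrable fun x => g x • f x :=
  memLp_one_iff_integrable.1 (hf.smul hg)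

theorem integral_smul_act {g : Rn n → ℂ} {f : Rn n → C3} (hg : MemLp g 2) (hf : MemLp f 2)
    (A : Matrix (Fin 3) (Fin 3) ℂ) : ∫ x, g x • act A (f x) = matCLM A (∫ x, g x • f x) := by
  rw [← ContinuousLinearMap.integral_comp_comm _ (integrable_smul_of_memLp hg hf)]
  simp only [map_smul, matCLM_apply]

/-- The right-hand side of the weak formulation, on the Fourier side. -/
theorem weak_rhs_eq (hσ : 1 ≤ σ) (φ : 𝓢(Rn n, ℂ)) (V : L2 n) :
    (∫ x, fracLaplacian (σ / 2) φ x • act A₀ (V x)) + ∫ x, φ x • act A₁ (V x) =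
      ∫ ξ, (𝓕⁻ φ) ξ • symb (freq σ ξ) ((𝓕 V : L2 n) ξ) := by
  have hφ : MemLp φ 2 (volume : Measure (Rn n)) := φ.memLp 2 volume
  have hψ : MemLp (𝓕⁻ φ : 𝓢(Rn n, ℂ)) 2 (volume : Measure (Rn n)) := (𝓕⁻ φ).memLp 2 volume
  obtain ⟨h1, h2⟩ := freq_mul_schwartz hσ (𝓕⁻ φ)
  have hV := Lp.memLp V
  have hFV := Lp.memLp (𝓕 V : L2 n)
  have h3 := memLp_fourier h1 h2
  rw [fracLaplacian_eq, integral_smul_act h3 hV, integral_smul_act hφ hV,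
    integral_fourier_smul h1 h2 h3, ← integral_fourierInv_smul_fourier φ V,
    ← ContinuousLinearMap.integral_comp_comm _ (integrable_smul_of_memLp h2 hFV),
    ← ContinuousLinearMap.integral_comp_comm _ (integrable_smul_of_memLp hψ hFV),
    ← integral_add (ContinuousLinearMap.integrable_comp _ (integrable_smul_of_memLp h2 hFV))
      (ContinuousLinearMap.integrable_comp _ (integrable_smul_of_memLp hψ hFV))]
  congr 1
  ext1 ξ
  simp only [symb, map_smul, _root_.add_apply, _root_.smul_apply,
    smul_add, smul_smul]
  rw [mul_comm]

/-- The weak formulation is equivalent to the one on the Fourier side. -/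
theorem isSolution_iff (hσ : 1 ≤ σ) (U₀ : L2 n) (U : ℝ → L2 n) :
    IsSolution σ U₀ U ↔ ContinuousOn (fun t => (𝓕 (U t) : L2 n)) (Set.Ici 0) ∧
      (𝓕 (U 0) : L2 n) = 𝓕 U₀ ∧ ∀ ψ : 𝓢(Rn n, ℂ), ∀ t : ℝ, 0 < t →
        HasDerivAt (fun τ : ℝ => ∫ ξ, ψ ξ • (𝓕 (U τ) : L2 n) ξ)
          (∫ ξ, ψ ξ • symb (freq σ ξ) ((𝓕 (U t) : L2 n) ξ)) t := by
  have hc : ContinuousOn (fun t => (𝓕 (U t) : L2 n)) (Set.Ici 0) ↔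
      ContinuousOn U (Set.Ici 0) :=
    (Lp.fourierTransformₗᵢ (Rn n) C3).toHomeomorph.comp_continuousOn_iff U (Set.Ici 0)
  have hi : (𝓕 (U 0) : L2 n) = 𝓕 U₀ ↔ U 0 = U₀ :=
    (Lp.fourierTransformₗᵢ (Rn n) C3).injective.eq_iff
  constructor
  · rintro ⟨h1, h2, h3⟩
    refine ⟨hc.2 h1, hi.2 h2, fun ψ t ht => ?_⟩
    have := h3 (𝓕 ψ) t ht
    rw [weak_rhs_eq hσ, FourierTransform.fourierInv_fourier_eq] at this
    convert this using 2 with τ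
    rw [← integral_fourierInv_smul_fourier (𝓕 ψ), FourierTransform.fourierInv_fourier_eq]
  · rintro ⟨h1, h2, h3⟩
    refine ⟨hc.1 h1, hi.1 h2, fun φ t ht => ?_⟩
    rw [weak_rhs_eq hσ]
    simp only [← integral_fourierInv_smul_fourier φ]
    exact h3 _ t ht

end Weak

/-! ### Pointwise decay of the propagator -/

/-- The decay rate at frequency `ρ`, up to a constant. -/
def rate (ρ : ℝ) : ℝ := ρ ^ 2 / (1 + ρ ^ 2) ^ 2

theorem rate_nonneg (ρ : ℝ) : 0 ≤ rate ρ := by unfold rate; positivity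

/-- Exponential decay of the real system satisfied by the real and the imaginary parts of
`(a + b, i (a - b), c)`, by means of a Lyapunov functional. -/
theorem lyapunov_decay {ρ : ℝ} (hρ : 0 ≤ ρ) {p q c : ℝ → ℝ}
    (hp : ∀ t, HasDerivAt p (ρ * q t + 2 * c t) t) (hq : ∀ t, HasDerivAt q (-(ρ * p t)) t)
    (hc : ∀ t, HasDerivAt c (-(p t / 2) - c t) t) {t : ℝ} (ht : 0 ≤ t) :
    p t ^ 2 + q t ^ 2 + c t ^ 2 ≤
      16 * Real.exp (-(rate ρ / 128 * t)) * (p 0 ^ 2 + q 0 ^ 2 + c 0 ^ 2) := by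
  set w : ℝ := 1 / (1 + ρ ^ 2) with hw
  have hw0 : 0 < w := by positivity
  have hw1 : w * (1 + ρ ^ 2) = 1 := by rw [hw]; field_simp
  have hη : rate ρ = ρ ^ 2 * w ^ 2 := by rw [rate, hw]; field_simp
  set η := rate ρ with hηd
  have hw2 : w ≤ 1 := by nlinarith [mul_nonneg hw0.le (sq_nonneg ρ)]
  have hη0 : 0 ≤ η := rate_nonneg ρ
  have hρw : ρ ^ 2 * w ≤ 1 := by nlinarith
  have hηw : η ≤ w := by rw [hη]; nlinarith
  have hy : ρ * w ^ 2 ≤ 1 := by nlinarith [sq_nonneg (ρ * w - 1), sq_nonneg (w - 1), sq_nonneg ρ]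
  have hy0 : 0 ≤ ρ * w ^ 2 := by positivity
  -- The energy (p² + q²)/4 + c² has derivative -2c². The term in c p adds dissipation of p² of size
  -- w, the term in p q dissipation of q² of size ρ²w² = η. The weights are such that the error w ρ
  -- c q is absorbed by c² and (ρ w q)², and the error η p² by w p².
  set L : ℝ → ℝ := fun t => (p t ^ 2 + q t ^ 2) / 4 + c t ^ 2 + w / 8 * (c t * p t) -
    ρ * w ^ 2 / 32 * (p t * q t) with hL
  set L' : ℝ → ℝ := fun t => -2 * c t ^ 2 + w / 8 * (-(p t ^ 2 / 2) - c t * p t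
    + ρ * (c t * q t) + 2 * c t ^ 2) - ρ * w ^ 2 / 32 * (ρ * q t ^ 2 + 2 * (c t * q t)
      - ρ * p t ^ 2) with hL'
  have hLd : ∀ t, HasDerivAt L (L' t) t := fun t => by
    have := (((((hp t).pow 2).add ((hq t).pow 2)).div_const 4).add ((hc t).pow 2)).add
      ((((hc t).mul (hp t)).const_mul (w / 8))) |>.sub
      (((hp t).mul (hq t)).const_mul (ρ * w ^ 2 / 32))
    refine this.congr_deriv ?_
    simp only [hL']
    push_cast
    ring
  have hcross : ∀ k x y : ℝ, 0 ≤ k → k ≤ 1 →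
      -((x ^ 2 + y ^ 2) / 2) ≤ k * (x * y) ∧ k * (x * y) ≤ (x ^ 2 + y ^ 2) / 2 := by
    intro k x y h0 h1
    constructor <;>
      nlinarith [mul_nonneg h0 (sq_nonneg (x + y)), mul_nonneg h0 (sq_nonneg (x - y)),
        mul_nonneg (sub_nonneg.2 h1) (sq_nonneg x), mul_nonneg (sub_nonneg.2 h1) (sq_nonneg y)]
  have hlow : ∀ t, p t ^ 2 + q t ^ 2 + c t ^ 2 ≤ 8 * L t := fun t => by
    have h1 := (hcross w (c t) (p t) hw0.le hw2).1
    have h2 := (hcross _ (p t) (q t) hy0 hy).2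
    simp only [hL]
    linarith [sq_nonneg (p t), sq_nonneg (q t), sq_nonneg (c t)]
  have hup : ∀ t, L t ≤ 2 * (p t ^ 2 + q t ^ 2 + c t ^ 2) := fun t => by
    have h1 := (hcross w (c t) (p t) hw0.le hw2).2
    have h2 := (hcross _ (p t) (q t) hy0 hy).1
    simp only [hL]
    linarith [sq_nonneg (p t), sq_nonneg (q t), sq_nonneg (c t)]
  -- The dissipation is at least η/64 times p² + q² + c², and L is at most twice this sum: hence
  -- η/128.
  have hdiss : ∀ t, L' t ≤ -(η / 128) * L t := fun t => by
    have h1 : w / 8 * -(c t * p t) ≤ w / 64 * p t ^ 2 + w / 4 * c t ^ 2 := by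
      nlinarith [mul_nonneg hw0.le (sq_nonneg (p t / 8 + c t / 2))]
    have h2 : (2 - w) / 16 * (c t * (ρ * w * q t)) ≤ η / 64 * q t ^ 2 + c t ^ 2 / 4 := by
      -- The scaling leaves (η/64) q² on the right, half of the available (η/32) q².
      have h3 := (hcross ((2 - w) / 2) (c t / 2) (ρ * w * q t / 8) (by linarith) (by linarith)).2
      have h4 : 0 ≤ c t ^ 2 := sq_nonneg _
      have h5 : 0 ≤ (ρ * w * q t) ^ 2 := sq_nonneg _
      have h6 : η / 64 * q t ^ 2 = (ρ * w * q t) ^ 2 / 64 := by rw [hη]; ring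
      rw [h6]
      linarith
    have h7 : L' t = -2 * c t ^ 2 - w / 16 * p t ^ 2 + w / 8 * -(c t * p t) +
        (2 - w) / 16 * (c t * (ρ * w * q t)) + w / 4 * c t ^ 2 - η / 32 * q t ^ 2 +
        η / 32 * p t ^ 2 := by
      simp only [hL', hη]
      ring
    have h8 := mul_le_mul_of_nonneg_left (hup t) hη0
    have h9 : η * p t ^ 2 ≤ w * p t ^ 2 := mul_le_mul_of_nonneg_right hηw (sq_nonneg _)
    have h10 : w * c t ^ 2 ≤ 1 * c t ^ 2 := mul_le_mul_of_nonneg_right hw2 (sq_nonneg _)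
    have h11 : η * c t ^ 2 ≤ w * c t ^ 2 := mul_le_mul_of_nonneg_right hηw (sq_nonneg _)
    linarith [sq_nonneg (c t)]
  have hanti : AntitoneOn (fun t => Real.exp (η / 128 * t) * L t) (Set.Ici 0) := by
    have hd : ∀ t, HasDerivAt (fun t => Real.exp (η / 128 * t) * L t)
        (Real.exp (η / 128 * t) * (η / 128) * L t + Real.exp (η / 128 * t) * L' t) t := fun t => by
      have := (((hasDerivAt_id t).const_mul (η / 128)).exp).mul (hLd t)
      refine this.congr_deriv ?_
      simp
    have ha : Antitone fun t => Real.exp (η / 128 * t) * L t :=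
      antitone_of_hasDerivAt_nonpos hd fun t => by
        have := mul_le_mul_of_nonneg_left (hdiss t) (Real.exp_pos (η / 128 * t)).le
        show _ ≤ (0 : ℝ)
        linarith
    exact ha.antitoneOn _
  have h0 := hanti Set.self_mem_Ici ht ht
  simp only [mul_zero, Real.exp_zero, one_mul] at h0
  have h1 : L t ≤ Real.exp (-(η / 128 * t)) * L 0 := by
    rw [Real.exp_neg, ← div_eq_inv_mul, le_div_iff₀ (Real.exp_pos _), mul_comm]
    exact h0
  have h2 := mul_le_mul_of_nonneg_left (hup 0) (Real.exp_pos (-(η / 128 * t))).le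
  linarith [hlow t]

/-- The semigroup generated by the symbol. -/
def prop (ρ t : ℝ) : C3 →L[ℂ] C3 := NormedSpace.exp ((t : ℂ) • symb ρ)

theorem prop_zero (ρ : ℝ) : prop ρ 0 = 1 := by
  have h : ((0 : ℝ) : ℂ) • symb ρ = 0 := by ext; simp
  rw [prop, h, NormedSpace.exp_zero]

theorem hasDerivAt_prop (ρ t : ℝ) (v : C3) :
    HasDerivAt (fun t => prop ρ t v) (symb ρ (prop ρ t v)) t := by
  have := (hasDerivAt_exp_smul_const' (𝕂 := ℂ) (symb ρ) t).clm_apply (hasDerivAt_const _ v)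
  refine (this.scomp t Complex.ofRealCLM.hasDerivAt).congr_deriv ?_
  simp only [Complex.ofRealCLM_apply, Complex.ofReal_one, one_smul, map_zero, add_zero]
  rfl

theorem continuous_prop (t : ℝ) : Continuous fun ρ => prop ρ t := by
  let : NormedAlgebra ℚ (C3 →L[ℂ] C3) := NormedAlgebra.restrictScalars ℚ ℂ _
  exact NormedSpace.exp_continuous.comp (continuous_symb.const_smul (t : ℂ))

theorem norm_sq_C3 (v : C3) : ‖v‖ ^ 2 = ‖v 0‖ ^ 2 + ‖v 1‖ ^ 2 + ‖v 2‖ ^ 2 := by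
  rw [EuclideanSpace.norm_sq_eq, Fin.sum_univ_three]

theorem symb_apply (ρ : ℝ) (v : C3) :
    symb ρ v 0 = ρ * Complex.I * v 0 + v 2 ∧ symb ρ v 1 = -(ρ * Complex.I * v 1) + v 2 ∧
      symb ρ v 2 = -(v 0 + v 1) / 2 - v 2 := by
  simp only [symb, _root_.add_apply, _root_.smul_apply, matCLM_apply, act]
  refine ⟨?_, ?_, ?_⟩ <;>
    simp [A₀, A₁, dotProduct, Fin.sum_univ_three] <;> ring

/-- In the variables u₀ + u₁, i(u₀ - u₁), u₂ the symbol has real coefficients, so real and imaginary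
parts decouple and the Lyapunov estimate applies to each. The change of variables costs at most 4,
whence 64 = 16 · 4 for the squares; the square root gives 8 and halves the rate. -/
theorem norm_prop_apply_le {ρ : ℝ} (hρ : 0 ≤ ρ) {t : ℝ} (ht : 0 ≤ t) (v : C3) :
    ‖prop ρ t v‖ ≤ 8 * Real.exp (-(rate ρ / 256 * t)) * ‖v‖ := by
  set u : ℝ → C3 := fun t => prop ρ t v with hu
  have hd : ∀ (i : Fin 3) t, HasDerivAt (fun t => u t i) (symb ρ (u t) i) t := fun i t =>
    ((EuclideanSpace.proj (𝕜 := ℂ) i).restrictScalars ℝ).hasFDerivAt.comp_hasDerivAt t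
      (hasDerivAt_prop ρ t v)
  have hre : ∀ (i : Fin 3) t, HasDerivAt (fun t => (u t i).re) (symb ρ (u t) i).re t := fun i t =>
    Complex.reCLM.hasFDerivAt.comp_hasDerivAt t (hd i t)
  have him : ∀ (i : Fin 3) t, HasDerivAt (fun t => (u t i).im) (symb ρ (u t) i).im t := fun i t =>
    Complex.imCLM.hasFDerivAt.comp_hasDerivAt t (hd i t)
  have h1 := lyapunov_decay hρ (p := fun t => (u t 0).re + (u t 1).re)
    (q := fun t => (u t 1).im - (u t 0).im) (c := fun t => (u t 2).re)
    (fun t => by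
      refine ((hre 0 t).add (hre 1 t)).congr_deriv ?_
      simp only [(symb_apply ρ _).1, (symb_apply ρ _).2.1]
      simp
      ring)
    (fun t => by
      refine ((him 1 t).sub (him 0 t)).congr_deriv ?_
      simp only [(symb_apply ρ _).1, (symb_apply ρ _).2.1]
      simp
      ring)
    (fun t => by
      refine (hre 2 t).congr_deriv ?_
      simp only [(symb_apply ρ _).2.2]
      simp
      ring) ht
  have h2 := lyapunov_decay hρ (p := fun t => (u t 0).im + (u t 1).im)
    (q := fun t => (u t 0).re - (u t 1).re) (c := fun t => (u t 2).im)
    (fun t => by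
      refine ((him 0 t).add (him 1 t)).congr_deriv ?_
      simp only [(symb_apply ρ _).1, (symb_apply ρ _).2.1]
      simp
      ring)
    (fun t => by
      refine ((hre 0 t).sub (hre 1 t)).congr_deriv ?_
      simp only [(symb_apply ρ _).1, (symb_apply ρ _).2.1]
      simp
      ring)
    (fun t => by
      refine (him 2 t).congr_deriv ?_
      simp only [(symb_apply ρ _).2.2]
      simp
      ring) ht
  have hn : ∀ t, ‖u t‖ ^ 2 = (u t 0).re ^ 2 + (u t 0).im ^ 2 + ((u t 1).re ^ 2 + (u t 1).im ^ 2)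
      + ((u t 2).re ^ 2 + (u t 2).im ^ 2) := fun t => by
    rw [norm_sq_C3]
    simp only [Complex.sq_norm, Complex.normSq_apply]
    ring
  have hu0 : ‖u 0‖ = ‖v‖ := by simp [hu, prop_zero]
  set e := Real.exp (-(rate ρ / 128 * t)) with he
  have he0 : 0 < e := Real.exp_pos _
  have hsq : ‖u t‖ ^ 2 ≤ 64 * e * ‖u 0‖ ^ 2 := by
    have k1 : ‖u t‖ ^ 2 ≤ ((u t 0).re + (u t 1).re) ^ 2 + ((u t 1).im - (u t 0).im) ^ 2
      + (u t 2).re ^ 2 + (((u t 0).im + (u t 1).im) ^ 2 + ((u t 0).re - (u t 1).re) ^ 2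
      + (u t 2).im ^ 2) := by
      rw [hn]
      nlinarith [sq_nonneg (u t 0).re, sq_nonneg (u t 1).re, sq_nonneg (u t 0).im,
        sq_nonneg (u t 1).im]
    have k2 : ((u 0 0).re + (u 0 1).re) ^ 2 + ((u 0 1).im - (u 0 0).im) ^ 2
      + (u 0 2).re ^ 2 + (((u 0 0).im + (u 0 1).im) ^ 2 + ((u 0 0).re - (u 0 1).re) ^ 2
      + (u 0 2).im ^ 2) ≤ 4 * ‖u 0‖ ^ 2 := by
      rw [hn]
      nlinarith [sq_nonneg (u 0 0).re, sq_nonneg (u 0 1).re, sq_nonneg (u 0 0).im,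
        sq_nonneg (u 0 1).im, sq_nonneg (u 0 2).re, sq_nonneg (u 0 2).im]
    have k3 := mul_le_mul_of_nonneg_left k2 he0.le
    linarith
  have hee : e = Real.exp (-(rate ρ / 256 * t)) ^ 2 := by
    rw [he, ← Real.exp_nat_mul]; congr 1; push_cast; ring
  rw [hu0] at hsq
  refine abs_le_of_sq_le_sq' ?_ (by positivity) |>.2
  calc ‖u t‖ ^ 2 ≤ _ := hsq
    _ = _ := by rw [hee]; ring

/-! ### Existence of the solution -/

section

variable {n : ℕ} {σ : ℝ}

theorem rate_exp_le_one {ρ t : ℝ} (ht : 0 ≤ t) : Real.exp (-(rate ρ / 256 * t)) ≤ 1 :=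
  Real.exp_le_one_iff.2 (by have := rate_nonneg ρ; simp only [Left.neg_nonpos_iff]; positivity)

theorem norm_prop_apply_le_const {ρ : ℝ} (hρ : 0 ≤ ρ) {t : ℝ} (ht : 0 ≤ t) (v : C3) :
    ‖prop ρ t v‖ ≤ 8 * ‖v‖ := by
  refine (norm_prop_apply_le hρ ht v).trans ?_
  have := rate_exp_le_one (ρ := ρ) ht
  gcongr
  linarith

theorem aestronglyMeasurable_clm_apply {T : ℝ → C3 →L[ℂ] C3} (hT : Continuous T) (hσ : 1 ≤ σ)
    (f : L2 n) : AEStronglyMeasurable (fun ξ => T (freq σ ξ) (f ξ)) volume :=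
  (ContinuousLinearMap.apply ℂ C3).flip.aestronglyMeasurable_comp₂
    (hT.comp (continuous_freq (zero_le_one.trans hσ))).aestronglyMeasurable (Lp.memLp f).1

theorem memLp_prop_apply (hσ : 1 ≤ σ) (f : L2 n) {t : ℝ} (ht : 0 ≤ t) :
    MemLp (fun ξ => prop (freq σ ξ) t (f ξ)) 2 (volume : Measure (Rn n)) := by
  refine (Lp.memLp f).of_le_mul (c := 8) (aestronglyMeasurable_clm_apply (continuous_prop t) hσ f)
    (Filter.Eventually.of_forall fun ξ => ?_)
  exact norm_prop_apply_le_const (freq_nonneg σ ξ) ht _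

/-- The evolution on the Fourier side, stationary for negative times. -/
def evol (hσ : 1 ≤ σ) (f : L2 n) (t : ℝ) : L2 n :=
  (memLp_prop_apply hσ f (le_max_right t 0)).toLp

theorem coeFn_evol (hσ : 1 ≤ σ) (f : L2 n) {t : ℝ} (ht : 0 ≤ t) :
    evol hσ f t =ᵐ[volume] fun ξ => prop (freq σ ξ) t (f ξ) := by
  filter_upwards [(memLp_prop_apply hσ f (le_max_right t 0)).coeFn_toLp] with ξ hξ
  rw [evol, hξ, max_eq_left ht]

theorem evol_zero (hσ : 1 ≤ σ) (f : L2 n) : evol hσ f 0 = f := by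
  apply Lp.ext
  filter_upwards [coeFn_evol hσ f le_rfl] with ξ hξ
  rw [hξ, prop_zero]
  rfl

theorem continuous_prop_time (ρ : ℝ) (v : C3) : Continuous fun t => prop ρ t v :=
  continuous_iff_continuousAt.2 fun t => (hasDerivAt_prop ρ t v).continuousAt

/-- Dominated convergence: at each frequency the orbit is continuous in time, and the difference of
two values is at most (8 + 8)|f|. -/
theorem continuous_evol (hσ : 1 ≤ σ) (f : L2 n) : Continuous (evol hσ f) := by
  rw [continuous_iff_continuousAt]
  intro t₀
  refine (Lp.tendsto_Lp_iff_tendsto_eLpNorm'' (fun t ξ => prop (freq σ ξ) (max t 0) (f ξ))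
    (fun t => memLp_prop_apply hσ f (le_max_right t 0)) _
    (memLp_prop_apply hσ f (le_max_right t₀ 0))).2 ?_
  have hlim : Filter.Tendsto (fun t => ∫⁻ ξ, ‖prop (freq σ ξ) (max t 0) (f ξ) -
      prop (freq σ ξ) (max t₀ 0) (f ξ)‖ₑ ^ (2 : ℝ)) (nhds t₀)
      (nhds (∫⁻ _ : Rn n, 0)) := by
    refine tendsto_lintegral_filter_of_dominated_convergence'
      (fun ξ => ‖(16 : ℂ) • f ξ‖ₑ ^ (2 : ℝ)) ?_ ?_ ?_ ?_
    · exact Filter.Eventually.of_forall fun t =>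
        ((memLp_prop_apply hσ f (le_max_right t 0)).sub
          (memLp_prop_apply hσ f (le_max_right t₀ 0))).1.enorm.pow_const _
    · refine Filter.Eventually.of_forall fun t => Filter.Eventually.of_forall fun ξ => ?_
      refine ENNReal.rpow_le_rpow ?_ (by norm_num)
      rw [enorm_le_iff_norm_le, norm_smul]
      refine (norm_sub_le _ _).trans ?_
      have h1 := norm_prop_apply_le_const (freq_nonneg σ ξ) (le_max_right t 0) (f ξ)
      have h2 := norm_prop_apply_le_const (freq_nonneg σ ξ) (le_max_right t₀ 0) (f ξ)
      norm_num
      linarith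
    · have := (((Lp.memLp f).const_smul (16 : ℂ)).eLpNorm_lt_top)
      rw [eLpNorm_eq_lintegral_rpow_enorm_toReal (by norm_num) (by norm_num)] at this
      simpa using (ENNReal.rpow_lt_top_iff_of_pos (by norm_num)).1 this |>.ne
    · refine Filter.Eventually.of_forall fun ξ => ?_
      have hc : Continuous fun t => ‖prop (freq σ ξ) (max t 0) (f ξ) -
          prop (freq σ ξ) (max t₀ 0) (f ξ)‖ₑ ^ (2 : ℝ) :=
        ENNReal.continuous_rpow_const.comp (continuous_enorm.comp
          (((continuous_prop_time _ _).comp (continuous_id.max continuous_const)).sub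
            continuous_const))
      have := hc.tendsto t₀
      simpa using this
  have h2 := (ENNReal.continuous_rpow_const (y := 1 / 2)).continuousAt.tendsto.comp hlim
  simp only [lintegral_zero, one_div] at h2
  rw [ENNReal.zero_rpow_of_pos (by norm_num)] at h2
  refine h2.congr fun t => ?_
  rw [eLpNorm_eq_lintegral_rpow_enorm_toReal (by norm_num) (by norm_num)]
  simp

/-- Differentiation under the integral sign on τ > 0, where the propagator is uniformly bounded. The
growth 1 + |ξ|^σ of the symbol is absorbed by the decay of ψ. -/
theorem hasDerivAt_integral_evol (hσ : 1 ≤ σ) (f : L2 n) (ψ : 𝓢(Rn n, ℂ)) {t : ℝ} (ht : 0 < t) :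
    HasDerivAt (fun τ : ℝ => ∫ ξ, ψ ξ • (evol hσ f τ) ξ)
      (∫ ξ, ψ ξ • symb (freq σ ξ) ((evol hσ f t) ξ)) t := by
  have hψ : MemLp ψ 2 (volume : Measure (Rn n)) := ψ.memLp 2 volume
  have hf := Lp.memLp f
  set K : ℝ := ‖matCLM A₀‖ + ‖matCLM A₁‖ with hK
  have h1 : (fun τ : ℝ => ∫ ξ, ψ ξ • (evol hσ f τ) ξ) =ᶠ[nhds t]
      fun τ => ∫ ξ, ψ ξ • prop (freq σ ξ) τ (f ξ) := by
    filter_upwards [lt_mem_nhds ht] with τ hτ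
    apply integral_congr_ae
    filter_upwards [coeFn_evol hσ f hτ.le] with ξ hξ
    rw [hξ]
  have h2 : ∫ ξ, ψ ξ • symb (freq σ ξ) ((evol hσ f t) ξ) =
      ∫ ξ, ψ ξ • symb (freq σ ξ) (prop (freq σ ξ) t (f ξ)) := by
    apply integral_congr_ae
    filter_upwards [coeFn_evol hσ f ht.le] with ξ hξ
    rw [hξ]
  rw [h2]
  refine HasDerivAt.congr_of_eventuallyEq ?_ h1
  have hb : Integrable fun ξ => 8 * K * (‖ψ ξ • f ξ‖ + ‖((freq σ ξ : ℂ) * ψ ξ) • f ξ‖) :=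
    ((integrable_smul_of_memLp hψ hf).norm.add
      (integrable_smul_of_memLp (freq_mul_schwartz hσ ψ).2 hf).norm).const_mul _
  refine (hasDerivAt_integral_of_dominated_loc_of_deriv_le (s := Set.Ioi 0) (Ioi_mem_nhds ht)
    (F' := fun τ ξ => ψ ξ • symb (freq σ ξ) (prop (freq σ ξ) τ (f ξ))) ?_ ?_ ?_ ?_ hb ?_).2
  · filter_upwards [lt_mem_nhds ht] with τ hτ
    exact (integrable_smul_of_memLp hψ (memLp_prop_apply hσ f hτ.le)).1
  · exact integrable_smul_of_memLp hψ (memLp_prop_apply hσ f ht.le)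
  · exact ψ.continuous.aestronglyMeasurable.smul (aestronglyMeasurable_clm_apply
      (T := fun ρ => symb ρ * prop ρ t) (continuous_symb.mul (continuous_prop t)) hσ f)
  · refine Filter.Eventually.of_forall fun ξ τ hτ => ?_
    have e1 := norm_symb_le (freq_nonneg σ ξ)
    have e2 := norm_prop_apply_le_const (freq_nonneg σ ξ) (le_of_lt hτ) (f ξ)
    have e3 := (symb (freq σ ξ)).le_opNorm (prop (freq σ ξ) τ (f ξ))
    have hK0 : 0 ≤ K := by positivity
    have hq := freq_nonneg σ ξ
    simp only [norm_smul, norm_mul, Complex.norm_real, Real.norm_of_nonneg hq]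
    calc ‖ψ ξ‖ * ‖symb (freq σ ξ) (prop (freq σ ξ) τ (f ξ))‖
        ≤ ‖ψ ξ‖ * ((K * (1 + freq σ ξ)) * (8 * ‖f ξ‖)) := by
          gcongr
          exact e3.trans (mul_le_mul e1 e2 (norm_nonneg _) (by positivity))
      _ = _ := by ring
  · exact Filter.Eventually.of_forall fun ξ τ _ => (hasDerivAt_prop _ _ _).const_smul (ψ ξ)

/-- The solution of the Cauchy problem. -/
def sol (hσ : 1 ≤ σ) (U₀ : L2 n) (t : ℝ) : L2 n := 𝓕⁻ (evol hσ (𝓕 U₀ : L2 n) t)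

theorem fourier_sol (hσ : 1 ≤ σ) (U₀ : L2 n) (t : ℝ) :
    (𝓕 (sol hσ U₀ t) : L2 n) = evol hσ (𝓕 U₀ : L2 n) t :=
  FourierTransform.fourier_fourierInv_eq _

theorem isSolution_sol (hσ : 1 ≤ σ) (U₀ : L2 n) : IsSolution σ U₀ (sol hσ U₀) := by
  rw [isSolution_iff hσ]
  simp only [fourier_sol]
  exact ⟨(continuous_evol hσ _).continuousOn, evol_zero hσ _,
    fun ψ t ht => hasDerivAt_integral_evol hσ _ ψ ht⟩

end

/-! ### Uniqueness by frequency cut-off -/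

section

variable {n : ℕ} {σ : ℝ}

/-- Multiplication by a bounded operator-valued function, on `L²`. -/
def mulOp (T : Lp (C3 →L[ℂ] C3) ∞ (volume : Measure (Rn n))) : L2 n →L[ℂ] L2 n :=
  (ContinuousLinearMap.id ℂ (C3 →L[ℂ] C3)).holderL volume ∞ 2 2 T

theorem coeFn_mulOp {T : Rn n → C3 →L[ℂ] C3} (hT : MemLp T ∞ volume) (f : L2 n) :
    mulOp hT.toLp f =ᵐ[volume] fun ξ => T ξ (f ξ) := by
  filter_upwards [(ContinuousLinearMap.id ℂ (C3 →L[ℂ] C3)).coeFn_holder (r := 2) hT.toLp f,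
    hT.coeFn_toLp] with ξ h1 h2
  rw [mulOp, ContinuousLinearMap.holderL_apply_apply, h1, h2]
  rfl

theorem memLp_top_indicator_ball {T : ℝ → C3 →L[ℂ] C3} (hT : Continuous T) (hσ : 1 ≤ σ) (R : ℝ) :
    MemLp ((Metric.ball (0 : Rn n) R).indicator fun ξ => T (freq σ ξ)) ∞ volume := by
  have hc : Continuous fun ξ : Rn n => T (freq σ ξ) :=
    hT.comp (continuous_freq (zero_le_one.trans hσ))
  obtain ⟨C, hC⟩ := (isCompact_closedBall (0 : Rn n) R).exists_bound_of_continuousOn hc.continuousOn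
  refine memLp_top_of_bound (hc.aestronglyMeasurable.indicator Metric.isOpen_ball.measurableSet)
    (max C 0) (Filter.Eventually.of_forall fun ξ => ?_)
  by_cases hξ : ξ ∈ Metric.ball (0 : Rn n) R
  · rw [Set.indicator_of_mem hξ]
    exact (hC ξ (Metric.ball_subset_closedBall hξ)).trans (le_max_left _ _)
  · rw [Set.indicator_of_notMem hξ, norm_zero]
    exact le_max_right _ _

/-- The frequency cut-off to a ball. -/
def cutoff (n : ℕ) {σ : ℝ} (hσ : 1 ≤ σ) (R : ℝ) : L2 n →L[ℂ] L2 n :=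
  mulOp (memLp_top_indicator_ball (T := fun _ => 1) continuous_const hσ R).toLp

/-- The symbol, cut off to a ball of frequencies. -/
def cutSymb (n : ℕ) {σ : ℝ} (hσ : 1 ≤ σ) (R : ℝ) : L2 n →L[ℂ] L2 n :=
  mulOp (memLp_top_indicator_ball continuous_symb hσ R).toLp

theorem coeFn_cutoff (hσ : 1 ≤ σ) (R : ℝ) (f : L2 n) :
    cutoff n hσ R f =ᵐ[volume] (Metric.ball 0 R).indicator f := by
  filter_upwards [coeFn_mulOp (memLp_top_indicator_ball (T := fun _ => 1) continuous_const hσ R) f]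
    with ξ h
  rw [cutoff, h]
  by_cases hξ : ξ ∈ Metric.ball (0 : Rn n) R <;> simp [hξ]

theorem coeFn_cutSymb (hσ : 1 ≤ σ) (R : ℝ) (f : L2 n) : cutSymb n hσ R f =ᵐ[volume]
    (Metric.ball 0 R).indicator fun ξ => symb (freq σ ξ) (f ξ) := by
  filter_upwards [coeFn_mulOp (memLp_top_indicator_ball continuous_symb hσ R) f] with ξ h
  rw [cutSymb, h]
  by_cases hξ : ξ ∈ Metric.ball (0 : Rn n) R <;> simp [hξ]

theorem cutoff_cutSymb (hσ : 1 ≤ σ) (R : ℝ) (f : L2 n) :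
    cutoff n hσ R (cutSymb n hσ R f) = cutSymb n hσ R f := by
  apply Lp.ext
  filter_upwards [coeFn_cutoff hσ R (cutSymb n hσ R f), coeFn_cutSymb hσ R f] with ξ h1 h2
  rw [h1]
  by_cases hξ : ξ ∈ Metric.ball (0 : Rn n) R <;> simp [hξ, h2]

theorem cutSymb_cutoff (hσ : 1 ≤ σ) (R : ℝ) (f : L2 n) :
    cutSymb n hσ R (cutoff n hσ R f) = cutSymb n hσ R f := by
  apply Lp.ext
  filter_upwards [coeFn_cutSymb hσ R (cutoff n hσ R f), coeFn_cutSymb hσ R f,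
    coeFn_cutoff hσ R f] with ξ h1 h2 h3
  rw [h1, h2]
  by_cases hξ : ξ ∈ Metric.ball (0 : Rn n) R <;> simp [hξ, h3]

/-- The pairing with a Schwartz function, as a continuous linear map on `L²`. -/
def pairing (ψ : 𝓢(Rn n, ℂ)) : L2 n →L[ℂ] C3 :=
  (ContinuousLinearMap.lsmul ℂ ℂ (E := C3)).lpPairing volume 2 2 (ψ.toLp 2)

theorem pairing_apply (ψ : 𝓢(Rn n, ℂ)) (f : L2 n) : pairing ψ f = ∫ ξ, ψ ξ • f ξ := by
  rw [pairing, ContinuousLinearMap.lpPairing_eq_integral]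
  apply integral_congr_ae
  filter_upwards [ψ.coeFn_toLp 2 volume] with x hx
  simp [hx]

/-- The cut-off of a weak solution satisfies an integral equation in `L²`. -/
theorem cutoff_eq_integral (hσ : 1 ≤ σ) {F : ℝ → L2 n} (hF : Continuous F)
    (h : ∀ ψ : 𝓢(Rn n, ℂ), ∀ t : ℝ, 0 < t → HasDerivAt (fun τ : ℝ => ∫ ξ, ψ ξ • (F τ) ξ)
      (∫ ξ, ψ ξ • symb (freq σ ξ) ((F t) ξ)) t) (R : ℝ) {t : ℝ} (ht : 0 ≤ t) :
    cutoff n hσ R (F t) = cutoff n hσ R (F 0) + ∫ r in 0..t, cutSymb n hσ R (F r) := by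
  have hB : Continuous fun r => cutSymb n hσ R (F r) := (cutSymb n hσ R).continuous.comp hF
  set I : L2 n := ∫ r in 0..t, cutSymb n hσ R (F r) with hI
  have hPI : cutoff n hσ R I = I := by
    rw [hI, ← ContinuousLinearMap.intervalIntegral_comp_comm _ (hB.intervalIntegrable 0 t)]
    simp only [cutoff_cutSymb]
  set G : L2 n := F t - F 0 - I with hG
  -- Test functions supported in the ball do not see the cut-off of the symbol, so the weak equation
  -- integrated in time says that G pairs to zero with them.
  have hG0 : ∀ᵐ ξ ∂(volume : Measure (Rn n)), ξ ∈ Metric.ball (0 : Rn n) R → G ξ = 0 := by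
    refine Metric.isOpen_ball.ae_eq_zero_of_integral_contDiff_smul_eq_zero
      (((Lp.memLp G).locallyIntegrable (by norm_num)).locallyIntegrableOn _) fun g hg hgc hgs => ?_
    let ψ : 𝓢(Rn n, ℂ) := HasCompactSupport.toSchwartzMap
      (f := fun x => (g x : ℂ)) (by exact hgc.comp_left Complex.ofReal_zero)
      (Complex.ofRealCLM.contDiff.comp hg)
    have hψ : ∀ x, ψ x = (g x : ℂ) := fun x => rfl
    have hd : ∀ r, pairing ψ (cutSymb n hσ R (F r)) =
        ∫ ξ, ψ ξ • symb (freq σ ξ) ((F r) ξ) := fun r => by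
      rw [pairing_apply]
      apply integral_congr_ae
      filter_upwards [coeFn_cutSymb hσ R (F r)] with ξ hξ
      rw [hξ]
      by_cases hm : ξ ∈ Metric.ball (0 : Rn n) R
      · rw [Set.indicator_of_mem hm]
      · have : g ξ = 0 := image_eq_zero_of_notMem_tsupport fun hh => hm (hgs hh)
        simp [hψ, this]
    have hFTC : ∫ r in 0..t, pairing ψ (cutSymb n hσ R (F r)) =
        pairing ψ (F t) - pairing ψ (F 0) := by
      -- The equation is known only for positive times; this form of the fundamental theorem asks
      -- for mere continuity at the endpoints.
      refine intervalIntegral.integral_eq_sub_of_hasDerivAt_of_le ht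
        ((pairing ψ).continuous.comp hF).continuousOn (fun r hr => ?_)
        (((pairing ψ).continuous.comp hB).intervalIntegrable 0 t)
      rw [hd]
      simp only [Function.comp_def, pairing_apply]
      exact h ψ r hr.1
    have hΛ : pairing ψ G = 0 := by
      rw [hG, map_sub, map_sub, ← hFTC, hI,
        ContinuousLinearMap.intervalIntegral_comp_comm _ (hB.intervalIntegrable 0 t), sub_self]
    rw [pairing_apply] at hΛ
    simpa [hψ, ← Complex.coe_smul] using hΛ
  have hPG : cutoff n hσ R G = 0 := by
    apply Lp.ext
    filter_upwards [coeFn_cutoff hσ R G, hG0, Lp.coeFn_zero C3 2 (volume : Measure (Rn n))]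
      with ξ h1 h2 h3
    rw [h1, h3]
    by_cases hξ : ξ ∈ Metric.ball (0 : Rn n) R <;> simp [hξ, h2]
  rw [hG, map_sub, map_sub, hPI, sub_eq_zero, sub_eq_iff_eq_add] at hPG
  rw [hPG, add_comm]

/-- Weak solutions on the Fourier side are determined by their initial values. -/
theorem weak_unique (hσ : 1 ≤ σ) {F G : ℝ → L2 n} (hF : Continuous F) (hG : Continuous G)
    (hF' : ∀ ψ : 𝓢(Rn n, ℂ), ∀ t : ℝ, 0 < t → HasDerivAt (fun τ : ℝ => ∫ ξ, ψ ξ • (F τ) ξ)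
      (∫ ξ, ψ ξ • symb (freq σ ξ) ((F t) ξ)) t)
    (hG' : ∀ ψ : 𝓢(Rn n, ℂ), ∀ t : ℝ, 0 < t → HasDerivAt (fun τ : ℝ => ∫ ξ, ψ ξ • (G τ) ξ)
      (∫ ξ, ψ ξ • symb (freq σ ξ) ((G t) ξ)) t)
    (h0 : F 0 = G 0) {t : ℝ} (ht : 0 ≤ t) : F t = G t := by
  have key : ∀ {F : ℝ → L2 n}, Continuous F → (∀ ψ : 𝓢(Rn n, ℂ), ∀ t : ℝ, 0 < t →
      HasDerivAt (fun τ : ℝ => ∫ ξ, ψ ξ • (F τ) ξ) (∫ ξ, ψ ξ • symb (freq σ ξ) ((F t) ξ)) t) →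
      ∀ R t, 0 ≤ t → HasDerivWithinAt (fun t => cutoff n hσ R (F t))
        (cutSymb n hσ R (cutoff n hσ R (F t))) (Set.Ici t) t := by
    intro F hF hF' R t ht
    have hB : Continuous fun r => cutSymb n hσ R (F r) := (cutSymb n hσ R).continuous.comp hF
    rw [cutSymb_cutoff]
    -- The integral formula is differentiable at every t, also at 0; it agrees with the cut-off of F
    -- only for nonnegative times, hence the one-sided derivative.
    have h1 : HasDerivAt (fun t => cutoff n hσ R (F 0) + ∫ r in 0..t, cutSymb n hσ R (F r))
        (cutSymb n hσ R (F t)) t :=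
      (intervalIntegral.integral_hasDerivAt_right (hB.intervalIntegrable 0 t)
        (hB.stronglyMeasurableAtFilter _ _) hB.continuousAt).const_add _
    exact h1.hasDerivWithinAt.congr_of_mem
      (fun x hx => cutoff_eq_integral hσ hF hF' R (ht.trans hx)) Set.self_mem_Ici
  have hcut : ∀ R : ℕ, cutoff n hσ R (F t) = cutoff n hσ R (G t) := fun R =>
    ODE_solution_unique_of_mem_Icc_right (v := fun _ => cutSymb n hσ R) (s := fun _ => Set.univ)
      (fun _ _ => (cutSymb n hσ R).lipschitz.lipschitzOnWith)
      ((cutoff n hσ R).continuous.comp hF).continuousOn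
      (fun r hr => key hF hF' R r hr.1) (fun _ _ => Set.mem_univ _)
      ((cutoff n hσ R).continuous.comp hG).continuousOn
      (fun r hr => key hG hG' R r hr.1) (fun _ _ => Set.mem_univ _)
      (by simp [h0]) (Set.right_mem_Icc.2 ht)
  apply Lp.ext
  -- Integer radii suffice to exhaust the space and give one common null set.
  have h1 : ∀ᵐ ξ ∂(volume : Measure (Rn n)), ∀ R : ℕ,
      (Metric.ball (0 : Rn n) R).indicator (F t) ξ =
        (Metric.ball (0 : Rn n) R).indicator (G t) ξ := by
    rw [ae_all_iff]
    intro R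
    filter_upwards [coeFn_cutoff hσ R (F t), coeFn_cutoff hσ R (G t)] with ξ e1 e2
    rw [← e1, ← e2, hcut]
  filter_upwards [h1] with ξ hξ
  obtain ⟨R, hR⟩ := exists_nat_gt ‖ξ‖
  have := hξ R
  rwa [Set.indicator_of_mem (by simpa using hR), Set.indicator_of_mem (by simpa using hR)] at this

/-- Negative times are unconstrained; freezing the solutions at their initial value there makes them
continuous on all of ℝ, as `weak_unique` requires. -/
theorem isSolution_unique (hσ : 1 ≤ σ) {U₀ : L2 n} {U V : ℝ → L2 n} (hU : IsSolution σ U₀ U)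
    (hV : IsSolution σ U₀ V) {t : ℝ} (ht : 0 ≤ t) : V t = U t := by
  have ext : ∀ {U : ℝ → L2 n}, IsSolution σ U₀ U →
      Continuous (fun t => (𝓕 (U (max t 0)) : L2 n)) ∧ ∀ ψ : 𝓢(Rn n, ℂ), ∀ t : ℝ, 0 < t →
        HasDerivAt (fun τ : ℝ => ∫ ξ, ψ ξ • (𝓕 (U (max τ 0)) : L2 n) ξ)
          (∫ ξ, ψ ξ • symb (freq σ ξ) ((𝓕 (U (max t 0)) : L2 n) ξ)) t := by
    intro U hU
    obtain ⟨h1, -, h3⟩ := (isSolution_iff hσ U₀ U).1 hU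
    refine ⟨h1.comp_continuous (continuous_id.max continuous_const) fun t => le_max_right t 0,
      fun ψ t ht => ?_⟩
    rw [max_eq_left ht.le]
    refine (h3 ψ t ht).congr_of_eventuallyEq ?_
    filter_upwards [lt_mem_nhds ht] with τ hτ
    rw [max_eq_left hτ.le]
  obtain ⟨hU1, hU2⟩ := ext hU
  obtain ⟨hV1, hV2⟩ := ext hV
  have := weak_unique hσ hV1 hU1 hV2 hU2 (by simp [hU.initial, hV.initial]) ht
  simp only [max_eq_left ht] at this
  exact (Lp.fourierTransformₗᵢ (Rn n) C3).injective this

end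

/-! ### An exponential bound, truncation at a height, and the weighted Fourier estimate -/

theorem exists_rpow_mul_exp_neg_le (a : ℝ) (ha : 0 ≤ a) {c : ℝ} (hc : 0 < c) :
    ∃ C : ℝ, 0 < C ∧ ∀ y : ℝ, 0 ≤ y → y ^ a * Real.exp (-(c * y)) ≤ C := by
  obtain ⟨N, hN⟩ := exists_nat_ge a
  refine ⟨1 + N.factorial / c ^ N, by positivity, fun y hy => ?_⟩
  have h1 : y ^ a ≤ 1 + y ^ N := by
    rcases le_total y 1 with h | h
    · have := Real.rpow_le_one hy h ha
      have : 0 ≤ y ^ N := by positivity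
      linarith
    · have := Real.rpow_le_rpow_of_exponent_le h hN
      rw [Real.rpow_natCast] at this
      linarith
  have h2 : (c * y) ^ N / N.factorial ≤ Real.exp (c * y) :=
    Real.pow_div_factorial_le_exp _ (by positivity) N
  have h3 : (1 : ℝ) ≤ Real.exp (c * y) := Real.one_le_exp (by positivity)
  rw [Real.exp_neg, ← div_eq_mul_inv, div_le_iff₀ (Real.exp_pos _)]
  have h4 : y ^ N ≤ N.factorial / c ^ N * Real.exp (c * y) := by
    rw [mul_pow, div_le_iff₀ (by positivity)] at h2
    rw [div_mul_eq_mul_div, le_div_iff₀ (by positivity)]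
    linarith
  linarith

section Truncation

variable {α E : Type*} [MeasurableSpace α] [NormedAddCommGroup E] {μ : Measure α}

/-- Where |f| > r, the nonpositive power |f|^(1-m) is at most r^(1-m). -/
theorem eLpNorm_one_indicator_lt_norm_le {f : α → E} {m r : ℝ} (hm : 1 ≤ m) (hr : 0 < r) :
    eLpNorm ({x | r < ‖f x‖}.indicator f) 1 μ ≤
      ENNReal.ofReal (r ^ (1 - m)) * ∫⁻ x, ENNReal.ofReal (‖f x‖ ^ m) ∂μ := by
  rw [eLpNorm_one_eq_lintegral_enorm, ← lintegral_const_mul' _ _ ENNReal.ofReal_ne_top]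
  refine lintegral_mono fun x => ?_
  by_cases hx : r < ‖f x‖
  · rw [Set.indicator_of_mem (by exact hx), ← ENNReal.ofReal_mul (by positivity), ← ofReal_norm]
    refine ENNReal.ofReal_le_ofReal ?_
    have hp : 0 < ‖f x‖ := hr.trans hx
    calc ‖f x‖ = ‖f x‖ ^ (1 - m) * ‖f x‖ ^ m := by
          rw [← Real.rpow_add hp]; simp
      _ ≤ _ := by
          gcongr ?_ * _
          exact Real.rpow_le_rpow_of_nonpos hr hx.le (by linarith)
  · rw [Set.indicator_of_notMem (by exact hx)]
    simp

/-- Where |f| ≤ r, the nonnegative power |f|^(2-m) is at most r^(2-m). -/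
theorem eLpNorm_two_indicator_norm_le_le {f : α → E} {m r : ℝ} (hm' : m ≤ 2)
    (hr : 0 < r) :
    eLpNorm ({x | r < ‖f x‖}ᶜ.indicator f) 2 μ ≤
      (ENNReal.ofReal (r ^ (2 - m)) * ∫⁻ x, ENNReal.ofReal (‖f x‖ ^ m) ∂μ) ^ (1 / 2 : ℝ) := by
  rw [eLpNorm_eq_lintegral_rpow_enorm_toReal (by norm_num) (by norm_num),
    ← lintegral_const_mul' _ _ ENNReal.ofReal_ne_top]
  simp only [ENNReal.toReal_ofNat]
  gcongr with x
  by_cases hx : r < ‖f x‖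
  · rw [Set.indicator_of_notMem (by simpa using hx)]
    simp
  · rw [Set.indicator_of_mem (by simpa using hx), ← ENNReal.ofReal_mul (by positivity),
      ← ofReal_norm, ENNReal.ofReal_rpow_of_nonneg (norm_nonneg _) (by norm_num)]
    refine ENNReal.ofReal_le_ofReal ?_
    rcases (norm_nonneg (f x)).eq_or_lt with h0 | hp
    · rw [← h0, Real.zero_rpow (by norm_num)]
      positivity
    calc ‖f x‖ ^ (2 : ℝ) = ‖f x‖ ^ (2 - m) * ‖f x‖ ^ m := by
          rw [← Real.rpow_add hp]; simp
      _ ≤ _ := by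
          gcongr ?_ * _
          exact Real.rpow_le_rpow hp.le (not_lt.1 hx) (by linarith)

theorem lintegral_norm_rpow_eq {f : α → E} {m : ℝ} (hm : 1 ≤ m)
    (hf : MemLp f (ENNReal.ofReal m) μ) : ∫⁻ x, ENNReal.ofReal (‖f x‖ ^ m) ∂μ =
      ENNReal.ofReal ((eLpNorm f (ENNReal.ofReal m) μ).toReal ^ m) := by
  have hm0 : 0 < m := by linarith
  have h1 : ∫⁻ x, ENNReal.ofReal (‖f x‖ ^ m) ∂μ = eLpNorm f (ENNReal.ofReal m) μ ^ m := by
    rw [eLpNorm_eq_lintegral_rpow_enorm_toReal (by simpa using hm0) ENNReal.ofReal_ne_top,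
      ENNReal.toReal_ofReal hm0.le, ← ENNReal.rpow_mul, one_div, inv_mul_cancel₀ hm0.ne',
      ENNReal.rpow_one]
    refine lintegral_congr fun x => ?_
    rw [← ofReal_norm, ENNReal.ofReal_rpow_of_nonneg (norm_nonneg _) hm0.le]
  rw [h1, ENNReal.toReal_rpow, ENNReal.ofReal_toReal]
  exact (ENNReal.rpow_lt_top_of_nonneg hm0.le hf.eLpNorm_lt_top.ne).ne

end Truncation

section LowFrequency

variable {n : ℕ}

/-- Weighted estimate for the Fourier transform of a function in `L² ∩ L^m`, obtained from its
splitting at height `r` into parts in `L¹` and `L²`. -/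
theorem eLpNorm_weight_smul_fourier_le {w : Rn n → ℝ} (hw : MemLp w 2) {A B : ℝ}
    (hA0 : 0 ≤ A) (hB0 : 0 ≤ B) (hA : eLpNorm w 2 volume ≤ ENNReal.ofReal A) (hB : ∀ ξ, ‖w ξ‖ ≤ B)
    {m r : ℝ} (hm : 1 ≤ m) (hm' : m ≤ 2) (hr : 0 < r) (f : L2 n)
    (hf : MemLp f (ENNReal.ofReal m) volume) :
    eLpNorm (fun ξ => w ξ • (𝓕 f : L2 n) ξ) 2 volume ≤
      ENNReal.ofReal (A * (r ^ (1 - m) * (eLpNorm f (ENNReal.ofReal m) volume).toReal ^ m) +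
        B * (r ^ (2 - m) * (eLpNorm f (ENNReal.ofReal m) volume).toReal ^ m) ^ (1 / 2 : ℝ)) := by
  set N := (eLpNorm f (ENNReal.ofReal m) volume).toReal with hN
  have hN0 : 0 ≤ N := ENNReal.toReal_nonneg
  set S : Set (Rn n) := {x | r < ‖f x‖} with hS
  have hSm : MeasurableSet S :=
    measurableSet_lt measurable_const (Lp.stronglyMeasurable f).norm.measurable
  have hJ := lintegral_norm_rpow_eq hm hf
  have hg1 : eLpNorm (S.indicator f) 1 volume ≤ ENNReal.ofReal (r ^ (1 - m) * N ^ m) := by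
    refine (eLpNorm_one_indicator_lt_norm_le hm hr).trans_eq ?_
    rw [hJ, ← ENNReal.ofReal_mul (by positivity)]
  have hh2 : eLpNorm (Sᶜ.indicator f) 2 volume ≤
      ENNReal.ofReal ((r ^ (2 - m) * N ^ m) ^ (1 / 2 : ℝ)) := by
    refine (eLpNorm_two_indicator_norm_le_le hm' hr).trans_eq ?_
    rw [hJ, ← ENNReal.ofReal_mul (by positivity),
      ENNReal.ofReal_rpow_of_nonneg (by positivity) (by norm_num)]
  have hg : MemLp (S.indicator f) 2 (volume : Measure (Rn n)) := (Lp.memLp f).indicator hSm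
  have hh : MemLp (Sᶜ.indicator f) 2 (volume : Measure (Rn n)) := (Lp.memLp f).indicator hSm.compl
  have hgi : Integrable (S.indicator f) (volume : Measure (Rn n)) :=
    memLp_one_iff_integrable.1 ⟨hg.1, hg1.trans_lt ENNReal.ofReal_lt_top⟩
  have hsum : f = hg.toLp + hh.toLp := by
    apply Lp.ext
    filter_upwards [Lp.coeFn_add hg.toLp hh.toLp, hg.coeFn_toLp, hh.coeFn_toLp] with x h1 h2 h3
    rw [h1, Pi.add_apply, h2, h3, Set.indicator_self_add_compl_apply]
  have hF : (𝓕 f : L2 n) =ᵐ[volume] fun ξ => 𝓕 (S.indicator f) ξ + (𝓕 hh.toLp : L2 n) ξ := by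
    have h1 : (𝓕 f : L2 n) = 𝓕 hg.toLp + 𝓕 hh.toLp := by
      conv_lhs => rw [hsum]
      exact FourierTransform.fourier_add _ _
    rw [h1]
    filter_upwards [Lp.coeFn_add (𝓕 hg.toLp : L2 n) (𝓕 hh.toLp), fourier_toLp_ae_eq hgi hg]
      with ξ h2 h3
    rw [h2, Pi.add_apply, h3]
  -- The L¹ part: its transform is bounded, so the L² norm of the weight enters.
  have e1 : eLpNorm (fun ξ => w ξ • 𝓕 (S.indicator f) ξ) 2 volume ≤
      ENNReal.ofReal (r ^ (1 - m) * N ^ m) * ENNReal.ofReal A := by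
    have hb : ∀ ξ, ‖w ξ • 𝓕 (S.indicator f) ξ‖ ≤ (r ^ (1 - m) * N ^ m) * ‖w ξ‖ := fun ξ => by
      rw [norm_smul, mul_comm]
      gcongr
      refine (norm_fourier_le_integral_norm _ ξ).trans ?_
      rw [eLpNorm_one_eq_lintegral_enorm] at hg1
      rw [integral_norm_eq_lintegral_enorm hgi.1]
      exact ENNReal.toReal_le_of_le_ofReal (by positivity) hg1
    exact (eLpNorm_le_mul_eLpNorm_of_ae_le_mul (Filter.Eventually.of_forall hb) 2).trans
      (by gcongr)
  -- The L² part: Plancherel, so the supremum of the weight enters.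
  have e2 : eLpNorm (fun ξ => w ξ • (𝓕 hh.toLp : L2 n) ξ) 2 volume ≤
      ENNReal.ofReal B * ENNReal.ofReal ((r ^ (2 - m) * N ^ m) ^ (1 / 2 : ℝ)) := by
    have hb : ∀ ξ, ‖w ξ • (𝓕 hh.toLp : L2 n) ξ‖ ≤ B * ‖(𝓕 hh.toLp : L2 n) ξ‖ := fun ξ => by
      rw [norm_smul]
      gcongr
      exact hB ξ
    refine (eLpNorm_le_mul_eLpNorm_of_ae_le_mul (Filter.Eventually.of_forall hb) 2).trans ?_
    gcongr
    have h3 : ‖(𝓕 hh.toLp : L2 n)‖ₑ = ‖hh.toLp‖ₑ := by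
      rw [← ofReal_norm, ← ofReal_norm, Lp.norm_fourier_eq]
    rw [Lp.enorm_def, Lp.enorm_def, eLpNorm_congr_ae hh.coeFn_toLp] at h3
    rw [h3]
    exact hh2
  have hFm := (continuous_fourier_of_integrable hgi).aestronglyMeasurable (μ := volume)
  have hcongr : (fun ξ => w ξ • (𝓕 f : L2 n) ξ) =ᵐ[volume]
      (fun ξ => w ξ • 𝓕 (S.indicator f) ξ) + fun ξ => w ξ • (𝓕 hh.toLp : L2 n) ξ := by
    filter_upwards [hF] with ξ hξ
    rw [hξ, smul_add, Pi.add_apply]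
  rw [eLpNorm_congr_ae hcongr]
  refine (eLpNorm_add_le (hw.1.smul hFm) (hw.1.smul (Lp.memLp _).1) (by norm_num)).trans ?_
  refine (add_le_add e1 e2).trans_eq ?_
  rw [← ENNReal.ofReal_mul (by positivity), ← ENNReal.ofReal_mul hB0,
    ← ENNReal.ofReal_add (by positivity) (by positivity)]
  congr 2
  ring

end LowFrequency

/-! ### Scaling at low frequencies, loss of regularity at high frequencies -/

section

variable {n : ℕ} {σ s : ℝ}

/-- The profile `|ξ|^s exp (-c |ξ|^(2σ))` of the decay at low frequencies. -/
def profile (n : ℕ) (σ s c : ℝ) (ξ : Rn n) : ℝ := freq s ξ * Real.exp (-(c * freq (2 * σ) ξ))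

theorem continuous_profile (hσ : 1 ≤ σ) (hs : 0 ≤ s) (c : ℝ) : Continuous (profile n σ s c) := by
  have h1 : Continuous (freq s : Rn n → ℝ) := continuous_freq hs
  have h2 : Continuous (freq (2 * σ) : Rn n → ℝ) := continuous_freq (by linarith)
  unfold profile
  fun_prop

theorem profile_nonneg (c : ℝ) (ξ : Rn n) : 0 ≤ profile n σ s c ξ :=
  mul_nonneg (freq_nonneg s ξ) (Real.exp_pos _).le

theorem exists_profile_le (n : ℕ) (hσ : 1 ≤ σ) (hs : 0 ≤ s) {c : ℝ} (hc : 0 < c) :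
    ∃ C : ℝ, 0 < C ∧ ∀ ξ, profile n σ s c ξ ≤ C * (1 + ‖ξ‖) ^ (-((n : ℝ) + 1)) := by
  obtain ⟨C, hC0, hC⟩ := exists_rpow_mul_exp_neg_le (s + (n + 1)) (by positivity) hc
  refine ⟨C * Real.exp (2 * c), by positivity, fun ξ => ?_⟩
  set κ := 2 * Real.pi * ‖ξ‖ with hκ
  have hκ0 : 0 ≤ κ := by positivity
  have hκξ : ‖ξ‖ ≤ κ := by
    have : 1 ≤ 2 * Real.pi := by linarith [Real.pi_gt_three]
    nlinarith [norm_nonneg ξ]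
  have h1 : κ ≤ 1 + κ ^ (2 * σ) := by
    rcases le_total κ 1 with h | h
    · have : 0 ≤ κ ^ (2 * σ) := by positivity
      linarith
    · have := Real.rpow_le_rpow_of_exponent_le h (by linarith : (1 : ℝ) ≤ 2 * σ)
      rw [Real.rpow_one] at this
      linarith
  -- From κ ≤ 1 + κ^(2σ) follows -cκ^(2σ) ≤ 2c - c(1 + κ), the source of the factor exp(2c).
  have h2 : Real.exp (-(c * κ ^ (2 * σ))) ≤ Real.exp (2 * c) * Real.exp (-(c * (1 + κ))) := by
    rw [← Real.exp_add]
    apply Real.exp_le_exp.2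
    nlinarith
  have h3 : κ ^ s ≤ (1 + κ) ^ s := Real.rpow_le_rpow hκ0 (by linarith) hs
  have h4 : (1 + ‖ξ‖) ^ ((n : ℝ) + 1) ≤ (1 + κ) ^ ((n : ℝ) + 1) := by gcongr
  have h5 := hC (1 + κ) (by positivity)
  rw [Real.rpow_add (by positivity)] at h5
  rw [Real.rpow_neg (by positivity), ← div_eq_mul_inv, le_div_iff₀ (by positivity)]
  calc profile n σ s c ξ * (1 + ‖ξ‖) ^ ((n : ℝ) + 1)
      ≤ ((1 + κ) ^ s * (Real.exp (2 * c) * Real.exp (-(c * (1 + κ))))) *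
          (1 + κ) ^ ((n : ℝ) + 1) := by
        unfold profile freq
        gcongr
    _ = ((1 + κ) ^ s * (1 + κ) ^ ((n : ℝ) + 1) * Real.exp (-(c * (1 + κ)))) *
          Real.exp (2 * c) := by ring
    _ ≤ _ := by gcongr

theorem memLp_profile (hσ : 1 ≤ σ) (hs : 0 ≤ s) {c : ℝ} (hc : 0 < c) :
    MemLp (profile n σ s c) 2 := by
  obtain ⟨C, -, hC⟩ := exists_profile_le n hσ hs hc
  refine (memLp_of_le_one_add_norm (continuous_profile hσ hs c).aestronglyMeasurable
    (C := C) fun ξ => ?_).2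
  rw [Real.norm_of_nonneg (profile_nonneg c ξ)]
  exact hC ξ

theorem eLpNorm_two_comp_inv_smul {f : Rn n → ℝ} (hf : MemLp f 2) (hfc : Continuous f) {R : ℝ}
    (hR : 0 < R) :
    MemLp (fun ξ => f (R⁻¹ • ξ)) 2 ∧ eLpNorm (fun ξ => f (R⁻¹ • ξ)) 2 volume =
      ENNReal.ofReal (R ^ ((n : ℝ) / 2) * (eLpNorm f 2 volume).toReal) := by
  have hm : AEStronglyMeasurable (fun ξ => f (R⁻¹ • ξ)) volume :=
    (hfc.comp (continuous_const_smul _)).aestronglyMeasurable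
  have h1 : MemLp (fun ξ => f (R⁻¹ • ξ)) 2 := by
    rw [memLp_two_iff_integrable_sq_norm hm]
    exact ((memLp_two_iff_integrable_sq_norm hf.1).1 hf).comp_smul (inv_ne_zero hR.ne')
  refine ⟨h1, ?_⟩
  rw [h1.eLpNorm_eq_integral_rpow_norm (by norm_num) (by norm_num),
    hf.eLpNorm_eq_integral_rpow_norm (by norm_num) (by norm_num)]
  rw [ENNReal.toReal_ofReal (by positivity)]
  congr 1
  have h2 := Measure.integral_comp_inv_smul_of_nonneg (volume : Measure (Rn n))
    (fun ξ => ‖f ξ‖ ^ (2 : ℝ)) hR.le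
  simp only [ENNReal.toReal_ofNat]
  rw [h2, finrank_euclideanSpace_fin, smul_eq_mul, Real.mul_rpow (by positivity) (by positivity),
    ← Real.rpow_natCast, ← Real.rpow_mul hR.le]
  congr 2

theorem freq_inv_smul (a : ℝ) {R : ℝ} (hR : 0 < R) (ξ : Rn n) :
    freq a (R⁻¹ • ξ) = R ^ (-a) * freq a ξ := by
  unfold freq
  rw [norm_smul, Real.norm_of_nonneg (by positivity), ← mul_assoc, mul_comm _ R⁻¹, mul_assoc,
    Real.mul_rpow (by positivity) (by positivity), Real.inv_rpow hR.le, Real.rpow_neg hR.le]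

/-- The contribution of the low frequencies. -/
theorem exists_eLpNorm_profile_smul_fourier_le (n : ℕ) (hσ : 1 ≤ σ) (hs : 0 ≤ s) {c : ℝ}
    (hc : 0 < c) {m : ℝ} (hm : 1 ≤ m) (hm' : m ≤ 2) :
    ∃ C : ℝ, 0 < C ∧ ∀ f : L2 n, MemLp f (ENNReal.ofReal m) volume → ∀ R : ℝ, 0 < R →
      eLpNorm (fun ξ => (R ^ s * profile n σ s c (R⁻¹ • ξ)) • (𝓕 f : L2 n) ξ) 2 volume ≤
        ENNReal.ofReal (C * R ^ (s + n * (1 / m - 1 / 2))) *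
          eLpNorm f (ENNReal.ofReal m) volume := by
  obtain ⟨B, hB0, hB⟩ := exists_profile_le n hσ hs hc
  have hw := memLp_profile (n := n) hσ hs hc
  set A := (eLpNorm (profile n σ s c) 2 volume).toReal with hA
  have hA0 : 0 ≤ A := ENNReal.toReal_nonneg
  refine ⟨A + B, by positivity, fun f hf R hR => ?_⟩
  have hm0 : 0 < m := by linarith
  set N := (eLpNorm f (ENNReal.ofReal m) volume).toReal with hN
  -- The height chosen below is proportional to the norm of f and must be positive, so f = 0 is
  -- treated apart.
  rcases eq_or_ne (eLpNorm f (ENNReal.ofReal m) volume) 0 with h0 | h0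
  · rw [eLpNorm_eq_zero_iff hf.1 (by simpa using hm0)] at h0
    have hf0 : f = 0 := (Lp.eq_zero_iff_ae_eq_zero).2 h0
    have : (𝓕 f : L2 n) = 0 := by
      rw [hf0]; exact (Lp.fourierTransformₗᵢ (Rn n) C3).map_zero
    have hz : (fun ξ => (R ^ s * profile n σ s c (R⁻¹ • ξ)) • (𝓕 f : L2 n) ξ) =ᵐ[volume]
        fun _ => (0 : C3) := by
      rw [this]
      filter_upwards [Lp.coeFn_zero C3 2 (volume : Measure (Rn n))] with ξ hξ
      rw [hξ, Pi.zero_apply, smul_zero]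
    rw [eLpNorm_congr_ae hz]
    simp
  have hNp : 0 < N := ENNReal.toReal_pos h0 hf.eLpNorm_lt_top.ne
  obtain ⟨k1, k2⟩ := eLpNorm_two_comp_inv_smul hw (continuous_profile hσ hs c) hR
  have hB' : ∀ ξ, profile n σ s c ξ ≤ B := fun ξ => by
    refine (hB ξ).trans (mul_le_of_le_one_right hB0.le ?_)
    exact Real.rpow_le_one_of_one_le_of_nonpos (by linarith [norm_nonneg ξ])
      (by linarith [Nat.cast_nonneg (α := ℝ) n])
  -- At this height r = N R^(n/m) both parts of the splitting scale like N R^(s + n(1/m - 1/2)).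
  have hr : 0 < N * R ^ ((n : ℝ) / m) := by positivity
  refine (eLpNorm_weight_smul_fourier_le (A := R ^ s * (R ^ ((n : ℝ) / 2) * A)) (B := R ^ s * B)
    (k1.const_mul (R ^ s)) (by positivity) (by positivity) ?_ (fun ξ => ?_) hm hm' hr f hf).trans ?_
  · refine (eLpNorm_const_smul_le (c := R ^ s) (f := fun ξ => profile n σ s c (R⁻¹ • ξ))).trans ?_
    rw [k2, ENNReal.ofReal_mul (p := R ^ s) (by positivity), ← ofReal_norm,
      Real.norm_of_nonneg (by positivity)]
  · rw [norm_mul, Real.norm_of_nonneg (by positivity), Real.norm_of_nonneg (profile_nonneg c _)]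
    gcongr
    exact hB' _
  · have e1 : (N * R ^ ((n : ℝ) / m)) ^ (1 - m) * N ^ m = N * R ^ ((n : ℝ) / m - n) := by
      rw [Real.mul_rpow hNp.le (by positivity), ← Real.rpow_mul hR.le, mul_right_comm,
        ← Real.rpow_add hNp]
      have : (n : ℝ) / m * (1 - m) = n / m - n := by field_simp
      rw [this]
      simp
    have e2 : ((N * R ^ ((n : ℝ) / m)) ^ (2 - m) * N ^ m) ^ (1 / 2 : ℝ) =
        N * R ^ ((n : ℝ) * (1 / m - 1 / 2)) := by
      rw [Real.mul_rpow hNp.le (by positivity), ← Real.rpow_mul hR.le, mul_right_comm,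
        ← Real.rpow_add hNp, Real.mul_rpow (by positivity) (by positivity),
        ← Real.rpow_mul hR.le, ← Real.rpow_mul hNp.le]
      have h1 : (n : ℝ) / m * (2 - m) * (1 / 2) = n * (1 / m - 1 / 2) := by field_simp
      have h2 : (2 - m + m) * (1 / 2 : ℝ) = 1 := by ring
      rw [h1, h2, Real.rpow_one]
    rw [← hN, e1, e2]
    conv_rhs => rw [← ENNReal.ofReal_toReal hf.eLpNorm_lt_top.ne]
    rw [← hN, ← ENNReal.ofReal_mul (by positivity)]
    refine ENNReal.ofReal_le_ofReal (le_of_eq ?_)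
    have h3 : R ^ s * R ^ ((n : ℝ) / 2) * R ^ ((n : ℝ) / m - n) =
        R ^ (s + n * (1 / m - 1 / 2)) := by
      rw [← Real.rpow_add hR, ← Real.rpow_add hR]
      congr 1
      ring
    have h4 : R ^ s * R ^ ((n : ℝ) * (1 / m - 1 / 2)) = R ^ (s + n * (1 / m - 1 / 2)) := by
      rw [← Real.rpow_add hR]
    calc _ = N * A * (R ^ s * R ^ ((n : ℝ) / 2) * R ^ ((n : ℝ) / m - n)) +
          N * B * (R ^ s * R ^ ((n : ℝ) * (1 / m - 1 / 2))) := by ring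
      _ = _ := by rw [h3, h4]; ring

/-- Decay at low frequencies, for `x = |ξ|`. -/
theorem exp_rate_le_of_le_one {x t : ℝ} (hx : 0 ≤ x) (hx1 : x ≤ 1) (hσ : 1 ≤ σ) (ht : 0 ≤ t) :
    Real.exp (-(rate (x ^ σ) / 256 * t)) ≤
      Real.exp 1 * Real.exp (-(1 / 1024 * (x ^ (2 * σ) * (1 + t)))) := by
  rw [← Real.exp_add]
  apply Real.exp_le_exp.2
  have h1 : (x ^ σ) ^ 2 = x ^ (2 * σ) := by
    rw [← Real.rpow_natCast, ← Real.rpow_mul hx, mul_comm]; norm_num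
  have h2 : x ^ (2 * σ) ≤ 1 := Real.rpow_le_one hx hx1 (by linarith)
  have h3 : 0 ≤ x ^ (2 * σ) := by positivity
  -- For x ≤ 1 the denominator of the rate is at most 4, and 1024 = 4 · 256. Passing from t to 1 + t
  -- costs at most x^(2σ)/1024 ≤ 1 in the exponent, covered by exp 1.
  have h4 : x ^ (2 * σ) / 4 ≤ rate (x ^ σ) := by
    unfold rate
    rw [h1]
    gcongr
    nlinarith
  have h5 := mul_le_mul_of_nonneg_right h4 ht
  nlinarith

/-- Decay at high frequencies, for `x = |ξ|`, with loss of regularity. -/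
theorem exists_exp_rate_le_of_one_le {ℓ : ℝ} (hσ : 1 ≤ σ) (hℓ : 0 ≤ ℓ) :
    ∃ C : ℝ, 0 < C ∧ ∀ x t : ℝ, 1 ≤ x → 0 ≤ t → Real.exp (-(rate (x ^ σ) / 256 * t)) ≤
      C * (1 + t) ^ (-(ℓ / (2 * σ))) * x ^ ℓ := by
  obtain ⟨C, hC0, hC⟩ := exists_rpow_mul_exp_neg_le (ℓ / (2 * σ)) (by positivity)
    (by norm_num : (0 : ℝ) < 1 / 1024)
  refine ⟨Real.exp 1 * C, by positivity, fun x t hx ht => ?_⟩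
  have hx0 : 0 < x := by linarith
  have h1 : (x ^ σ) ^ 2 = x ^ (2 * σ) := by
    rw [← Real.rpow_natCast, ← Real.rpow_mul hx0.le, mul_comm]; norm_num
  set z := x ^ (2 * σ) with hz
  have hz1 : 1 ≤ z := Real.one_le_rpow hx (by linarith)
  have hz0 : 0 < z := by linarith
  have h4 : 1 / (4 * z) ≤ rate (x ^ σ) := by
    unfold rate
    rw [h1, div_le_div_iff₀ (by positivity) (by positivity)]
    nlinarith
  have h5 : Real.exp (-(rate (x ^ σ) / 256 * t)) ≤
      Real.exp 1 * Real.exp (-(1 / 1024 * ((1 + t) / z))) := by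
    rw [← Real.exp_add]
    apply Real.exp_le_exp.2
    have h6 := mul_le_mul_of_nonneg_right h4 ht
    have h7 : 1 / 1024 * ((1 + t) / z) = 1 / (4 * z) * t / 256 + 1 / 1024 * (1 / z) := by
      field_simp; ring
    have h8 : 1 / z ≤ 1 := by rw [div_le_one hz0]; exact hz1
    rw [h7]
    linarith
  -- Bounding the exponential by a power of (1 + t)/z with exponent ℓ/(2σ) turns z into the lost
  -- factor x^ℓ.
  have h9 := hC ((1 + t) / z) (by positivity)
  have h10 : ((1 + t) / z) ^ (ℓ / (2 * σ)) = (1 + t) ^ (ℓ / (2 * σ)) / x ^ ℓ := by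
    rw [Real.div_rpow (by positivity) hz0.le, hz, ← Real.rpow_mul hx0.le]
    congr 2
    field_simp
  rw [h10, div_mul_eq_mul_div, div_le_iff₀ (by positivity)] at h9
  rw [Real.rpow_neg (by positivity)]
  refine h5.trans ?_
  rw [mul_assoc, mul_assoc]
  gcongr
  have h11 : C * (((1 + t) ^ (ℓ / (2 * σ)))⁻¹ * x ^ ℓ) = C * x ^ ℓ / (1 + t) ^ (ℓ / (2 * σ)) := by
    ring
  rw [h11, le_div_iff₀ (by positivity)]
  linarith

/-- The pointwise bound of the solution on the Fourier side. -/
theorem exists_norm_prop_le (n : ℕ) {ℓ : ℝ} (hσ : 1 ≤ σ) (hs : 0 ≤ s) (hℓ : 0 ≤ ℓ) :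
    ∃ K : ℝ, 0 < K ∧ ∀ t : ℝ, 0 ≤ t → ∀ (ξ : Rn n) (v : C3),
      ‖(2 * Real.pi * ‖ξ‖) ^ s • prop (freq σ ξ) t v‖ ≤
        K * (‖(((1 + t) ^ (-(1 / (2 * σ)))) ^ s *
            profile n σ s (1 / 1024) (((1 + t) ^ (-(1 / (2 * σ))))⁻¹ • ξ)) • v‖ +
          (1 + t) ^ (-(ℓ / (2 * σ))) *
            ‖(1 + (2 * Real.pi * ‖ξ‖) ^ 2) ^ ((s + ℓ) / 2) • v‖) := by
  obtain ⟨C, hC0, hC⟩ := exists_exp_rate_le_of_one_le (σ := σ) hσ hℓ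
  refine ⟨8 * (Real.exp 1 + C), by positivity, fun t ht ξ v => ?_⟩
  set x := 2 * Real.pi * ‖ξ‖ with hx
  have hx0 : 0 ≤ x := by positivity
  set R := (1 + t) ^ (-(1 / (2 * σ))) with hR
  have hRp : 0 < R := by positivity
  -- R is chosen so that R^(-2σ) = 1 + t; the powers R^s and R^(-s) cancel.
  have hprop : R ^ s * profile n σ s (1 / 1024) (R⁻¹ • ξ) =
      x ^ s * Real.exp (-(1 / 1024 * (x ^ (2 * σ) * (1 + t)))) := by
    have h1 : R ^ (-(2 * σ)) = 1 + t := by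
      rw [hR, ← Real.rpow_mul (by positivity)]
      have : -(1 / (2 * σ)) * -(2 * σ) = 1 := by field_simp
      rw [this, Real.rpow_one]
    rw [profile, freq_inv_smul s hRp, freq_inv_smul (2 * σ) hRp, h1, ← mul_assoc, ← mul_assoc,
      ← Real.rpow_add hRp, add_neg_cancel, Real.rpow_zero, one_mul, freq, freq, mul_comm (1 + t)]
  rw [hprop]
  have h2 := norm_prop_apply_le (freq_nonneg σ ξ) ht v
  have hj : (0 : ℝ) ≤ (1 + x ^ 2) ^ ((s + ℓ) / 2) := by positivity
  rw [norm_smul, norm_smul, norm_smul, Real.norm_of_nonneg (by positivity),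
    Real.norm_of_nonneg (by positivity), Real.norm_of_nonneg hj]
  set e := Real.exp (-(1 / 1024 * (x ^ (2 * σ) * (1 + t)))) with he
  set q := (1 + t) ^ (-(ℓ / (2 * σ))) with hq
  have hq0 : 0 ≤ q := by positivity
  have h3 : freq σ ξ = x ^ σ := rfl
  rw [h3] at h2 ⊢
  have key : x ^ s * Real.exp (-(rate (x ^ σ) / 256 * t)) ≤
      (Real.exp 1 + C) * (x ^ s * e + q * (1 + x ^ 2) ^ ((s + ℓ) / 2)) := by
    have hA : 0 ≤ x ^ s * e := by positivity
    have hB : 0 ≤ q * (1 + x ^ 2) ^ ((s + ℓ) / 2) := by positivity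
    have hE := Real.exp_pos 1
    rcases le_total x 1 with h | h
    · have h4 := exp_rate_le_of_le_one hx0 h hσ ht
      have h5 := mul_le_mul_of_nonneg_left h4 (Real.rpow_nonneg hx0 s)
      have : Real.exp 1 * (x ^ s * e) ≤
          (Real.exp 1 + C) * (x ^ s * e + q * (1 + x ^ 2) ^ ((s + ℓ) / 2)) := by
        gcongr <;> linarith
      linarith
    · have hxp : 0 < x := by linarith
      have h4 := hC x t h ht
      have h5 := mul_le_mul_of_nonneg_left h4 (Real.rpow_nonneg hx0 s)
      have h6 : x ^ s * x ^ ℓ ≤ (1 + x ^ 2) ^ ((s + ℓ) / 2) := by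
        have h7 : x ^ s * x ^ ℓ = (x ^ 2) ^ ((s + ℓ) / 2) := by
          rw [← Real.rpow_add hxp, ← Real.rpow_natCast, ← Real.rpow_mul hx0]
          congr 1
          push_cast
          ring
        rw [h7]
        exact Real.rpow_le_rpow (by positivity) (by linarith) (by positivity)
      calc x ^ s * Real.exp (-(rate (x ^ σ) / 256 * t))
          ≤ C * (q * (x ^ s * x ^ ℓ)) := by linarith
        _ ≤ C * (q * (1 + x ^ 2) ^ ((s + ℓ) / 2)) := by gcongr
        _ ≤ _ := by gcongr <;> linarith
  calc x ^ s * ‖prop (x ^ σ) t v‖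
      ≤ x ^ s * (8 * Real.exp (-(rate (x ^ σ) / 256 * t)) * ‖v‖) := by gcongr
    _ = 8 * (x ^ s * Real.exp (-(rate (x ^ σ) / 256 * t))) * ‖v‖ := by ring
    _ ≤ 8 * ((Real.exp 1 + C) * (x ^ s * e + q * (1 + x ^ 2) ^ ((s + ℓ) / 2))) * ‖v‖ := by gcongr
    _ = _ := by ring

end

end SigmaEvolution

end

/-! ### The main theorem -/

open SigmaEvolution in
theorem theorem2p1 (n : ℕ) (hn : 1 ≤ n) (σ s ℓ m : ℝ) (hσ : 1 ≤ σ) (hs : 0 ≤ s) (hℓ : 0 ≤ ℓ)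
    (hm₁ : 1 ≤ m) (hm₂ : m ≤ 2) :
    ∃ C : ℝ, 0 < C ∧ ∀ U₀ : SigmaEvolution.L2 n, SigmaEvolution.MemH (s + ℓ) U₀ →
      MemLp U₀ (ENNReal.ofReal m) volume →
      ∃ U : ℝ → SigmaEvolution.L2 n, SigmaEvolution.IsSolution σ U₀ U ∧
        (∀ V : ℝ → SigmaEvolution.L2 n, SigmaEvolution.IsSolution σ U₀ V →
          ∀ t : ℝ, 0 ≤ t → V t = U t) ∧
        ∀ t : ℝ, 0 ≤ t →
          SigmaEvolution.homSobolevNorm s (U t) ≤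
            ENNReal.ofReal C *
              (ENNReal.ofReal ((1 + t) ^ (-((n : ℝ) / (2 * σ)) * (1 / m - 1 / 2) - s / (2 * σ))) *
                  eLpNorm U₀ (ENNReal.ofReal m) volume +
                ENNReal.ofReal ((1 + t) ^ (-(ℓ / (2 * σ)))) *
                  SigmaEvolution.sobolevNorm (s + ℓ) U₀) := by
  obtain ⟨K, hK0, hK⟩ := exists_norm_prop_le n hσ hs hℓ
  obtain ⟨D, hD0, hD⟩ := exists_eLpNorm_profile_smul_fourier_le n hσ hs
    (by norm_num : (0 : ℝ) < 1 / 1024) hm₁ hm₂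
  -- K comes from the pointwise bound and D from the L^m estimate; the Sobolev term needs only the
  -- summand 1.
  refine ⟨K * (D + 1), by positivity, fun U₀ _ hU₀ => ⟨sol hσ U₀, isSolution_sol hσ U₀,
    fun V hV t ht => isSolution_unique hσ (isSolution_sol hσ U₀) hV ht, fun t ht => ?_⟩⟩
  set R := (1 + t) ^ (-(1 / (2 * σ))) with hR
  have hRp : 0 < R := by positivity
  set q := (1 + t) ^ (-(ℓ / (2 * σ))) with hq
  have hq0 : 0 ≤ q := by positivity
  set f1 : Rn n → C3 := fun ξ =>
    (R ^ s * profile n σ s (1 / 1024) (R⁻¹ • ξ)) • (𝓕 U₀ : L2 n) ξ with hf1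
  set f2 : Rn n → C3 := fun ξ =>
    (1 + (2 * Real.pi * ‖ξ‖) ^ 2) ^ ((s + ℓ) / 2) • (𝓕 U₀ : L2 n) ξ with hf2
  have hm1 : AEStronglyMeasurable f1 volume :=
    (continuous_const.mul ((continuous_profile hσ hs _).comp
      (continuous_const_smul _))).aestronglyMeasurable.smul (Lp.memLp _).1
  have hm2 : AEStronglyMeasurable f2 volume := by
    have : Continuous fun ξ : Rn n => (1 + (2 * Real.pi * ‖ξ‖) ^ 2) ^ ((s + ℓ) / 2) :=
      Continuous.rpow_const (by fun_prop) fun _ => Or.inr (by positivity)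
    exact this.aestronglyMeasurable.smul (Lp.memLp _).1
  have h1 : homSobolevNorm s (sol hσ U₀ t) ≤
      ENNReal.ofReal K * eLpNorm (fun ξ => ‖f1 ξ‖ + q * ‖f2 ξ‖) 2 volume := by
    unfold homSobolevNorm
    rw [fourier_sol]
    refine eLpNorm_le_mul_eLpNorm_of_ae_le_mul ?_ 2
    filter_upwards [coeFn_evol hσ (𝓕 U₀ : L2 n) ht] with ξ hξ
    rw [hξ, Real.norm_of_nonneg (by positivity)]
    exact hK t ht ξ _
  have h2 : eLpNorm (fun ξ => ‖f1 ξ‖ + q * ‖f2 ξ‖) 2 volume ≤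
      eLpNorm f1 2 volume + ENNReal.ofReal q * sobolevNorm (s + ℓ) U₀ := by
    refine (eLpNorm_add_le (f := fun ξ => ‖f1 ξ‖) (g := fun ξ => q * ‖f2 ξ‖) hm1.norm
      (hm2.norm.const_mul q) (by norm_num)).trans ?_
    gcongr
    · rw [eLpNorm_norm]
    · refine (eLpNorm_const_smul_le (c := q) (f := fun ξ => ‖f2 ξ‖)).trans ?_
      rw [eLpNorm_norm, ← ofReal_norm, Real.norm_of_nonneg hq0]
      rfl
  have h3 : R ^ (s + n * (1 / m - 1 / 2)) =
      (1 + t) ^ (-((n : ℝ) / (2 * σ)) * (1 / m - 1 / 2) - s / (2 * σ)) := by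
    rw [hR, ← Real.rpow_mul (by positivity)]
    congr 1
    field_simp
    ring
  have h4 := hD U₀ hU₀ R hRp
  rw [h3, ENNReal.ofReal_mul hD0.le, mul_assoc] at h4
  refine h1.trans ?_
  rw [ENNReal.ofReal_mul hK0.le, mul_assoc]
  gcongr
  refine h2.trans ?_
  rw [mul_add]
  refine add_le_add ?_ ?_
  · refine h4.trans ?_
    gcongr
    linarith
  · refine le_mul_of_one_le_left zero_le ?_
    rw [ENNReal.one_le_ofReal]
    linarith
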